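/- **Model.** In round $k=1,\dots,K$ a block of $N_k\ge 1$ complex symbols is sent over the channel $\mathbf y_k=\sqrt{P_k}\,h_k\,\mathbf x_k+\mathbf z_k$, where $P_k>0$ and $\mathbf z_k$ is white circularly symmetric complex Gaussian noise of variance $\sigma^2>0$. The receiver knows $h_k$. Put $\gamma_k=|h_k|^2P_k/\sigma^2$, and let $I_k=I(\mathbf x_k;\mathbf y_k)$ be the mutual information in bits when the entries of $\mathbf x_k$ are i.i.d. $\mathcal{CN}(0,1)$. In round $k$ a new message $m_k$ of $b_k\ge 0$ bits is added ($b_k$ real), and the codeword of round $k$ is a function $\mathbf x_k=\Phi_k(m_1,\dots,m_k)$. Asymptotics are for a scale $n\to\infty$: block lengths $nN_k$ and, for a rate back-off $\delta>0$, $\lceil 2^{n(b_k-\delta)}\rceil$ values of $m_k$. In the Gaussian codebook with joint-typicality decoding, all symbols of all codewords are i.i.d. $\mathcal{CN}(0,1)$ and the messages are uniform. After round $k$ the decoder returns the unique $(\tilde m_1,\dots,\tilde m_k)$ such that, for each $j\le k$, the codeword $\Phi_j(\tilde m_1,\dots,\tilde m_j)$ and $\mathbf y_j$ are jointly $\varepsilon$-typical,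 that is, $-\frac1{nN_j}\log_2$ of the input density, of the output density and of the joint density are each within $\varepsilon$ of the corresponding differential entropy per symbol; if there is not exactly one such tuple, it declares an error. Decoding fails after round $k$ if the decoder does not return $(m_1,\dots,m_k)$. **Theorem.** 1. $I_k=N_k\log_2(1+\gamma_k)$, for each channel state $h_k$. 2. (Two rounds, fixed $h_1,h_2$.) If $$b_1+b_2\le I_1+I_2,\qquad b_2\le I_2,\qquad b_1\le I_1+I_2,$$ then for every $\delta>0$: (a) for all sufficiently small $\varepsilon>0$, the probability that joint-typicality decoding fails after round 2, averaged over the Gaussian codebook, the messages and the noise, tends to $0$ as $n\to\infty$; (b) there are HARQ codes (encoders $\Phi_1,\Phi_2$ whose codewords have average symbol power at most $1$, and a decoder of $(m_1,m_2)$ from $(\mathbf y_1,\mathbf y_2)$), one for each $n$, whose maximal probability of error over all $(m_1,m_2)$ tends to $0$ as $n\to\infty$. 3. ($K$ rounds.) Let $h=(h_1,\dots,h_K)$ be random with any joint law (for instance block Rayleigh fading), independent of the codebook, the messages and the noise. Let $p_{out,K}$ be the probability that joint-typicality decoding with a Gaussian codebook fails after each of the rounds $1,\dots,K$, in the limit $n\to\infty$,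 then $\varepsilon\downarrow0$, then $\delta\downarrow0$: for every $\eta>0$, for all sufficiently small $\delta>0$, for all sufficiently small $\varepsilon>0$ and for all sufficiently large $n$, the failure probability is within $\eta$ of $p_{out,K}$. This limit exists and $$p_{out,K}=\Pr\Bigl(\bigcap_{k=1}^K\Bigl\{\sum_{l=1}^kN_l\log_2(1+\gamma_l)<\sum_{l=1}^kb_l\Bigr\}\Bigr).$$ -/

import Mathlib

open MeasureTheory ProbabilityTheory Filter Topology
open scoped ENNReal BigOperators

noncomputable section

namespace XPHARQ

/-! ### Complex Gaussian laws and the fading channel -/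

/-- Density on `ℂ` of the circularly symmetric complex Gaussian law of mean `0`, variance `v`. -/
def gaussDensity (v : ℝ) (z : ℂ) : ℝ := (Real.pi * v)⁻¹ * Real.exp (-(‖z‖ ^ 2) / v)

/-- The circularly symmetric complex Gaussian law of mean `0` and variance `v`. -/
def complexGaussian (v : ℝ) : Measure ℂ :=
  volume.withDensity fun z => ENNReal.ofReal (gaussDensity v z)

/-- Received signal-to-noise ratio, for channel coefficient `h`, average transmit power `P`
and noise variance `σ ^ 2`. -/
def snr (P σ : ℝ) (h : ℂ) : ℝ := ‖h‖ ^ 2 * P / σ ^ 2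

/-- One round of the channel, `y = √P h x + z`. -/
def received {n : ℕ} (P : ℝ) (h : ℂ) (x z : Fin n → ℂ) : Fin n → ℂ :=
  fun i => ((Real.sqrt P : ℝ) : ℂ) * h * x i + z i

/-- Joint law of the input and the output of one round of `n` symbols, the inputs being i.i.d.
complex Gaussian of unit variance. -/
def inputOutputLaw (n : ℕ) (P σ : ℝ) (h : ℂ) : Measure ((Fin n → ℂ) × (Fin n → ℂ)) :=
  ((Measure.pi fun _ : Fin n => complexGaussian 1).prod
      (Measure.pi fun _ : Fin n => complexGaussian (σ ^ 2))).map
    fun q => (q.1, received P h q.1 q.2)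

/-- Mutual information, in nats, of a pair with joint law `J`. -/
def mutualInfoNats {α β : Type*} [MeasurableSpace α] [MeasurableSpace β]
    (J : Measure (α × β)) : ℝ≥0∞ :=
  InformationTheory.klDiv J (J.fst.prod J.snd)

/-- `I(𝐱; 𝐲)` in bits, for one round of `n` symbols. -/
def mutualInfo (n : ℕ) (P σ : ℝ) (h : ℂ) : ℝ :=
  (mutualInfoNats (inputOutputLaw n P σ h)).toReal / Real.log 2

/-! ### Joint typicality -/

/-- Differential entropy, in bits, of a probability density. -/
def diffEntropy {α : Type*} [MeasureSpace α] (f : α → ℝ) : ℝ :=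
  -∫ x, f x * Real.logb 2 (f x)

/-- The sequence `w` is `ε`-typical for the density `f`:
`|-(1/n) log₂ (f(w₁) ⋯ f(wₙ)) - h(f)| < ε`. -/
def Typical {α : Type*} [MeasureSpace α] {n : ℕ} (ε : ℝ) (f : α → ℝ) (w : Fin n → α) : Prop :=
  |-(1 / (n : ℝ)) * Real.logb 2 (∏ i, f (w i)) - diffEntropy f| < ε

/-- Density of one output symbol. -/
def outputDensity (P σ : ℝ) (h : ℂ) (y : ℂ) : ℝ := gaussDensity (P * ‖h‖ ^ 2 + σ ^ 2) y

/-- Joint density of one input symbol and the corresponding output symbol. -/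
def jointDensity (P σ : ℝ) (h : ℂ) (q : ℂ × ℂ) : ℝ :=
  gaussDensity 1 q.1 * gaussDensity (σ ^ 2) (q.2 - ((Real.sqrt P : ℝ) : ℂ) * h * q.1)

/-- `(x, y)` lies in the jointly typical set of the Gaussian input and its channel output. -/
def JointlyTypical {n : ℕ} (P σ : ℝ) (h : ℂ) (ε : ℝ) (x y : Fin n → ℂ) : Prop :=
  Typical ε (gaussDensity 1) x ∧ Typical ε (outputDensity P σ h) y ∧
    Typical ε (jointDensity P σ h) fun i => (x i, y i)

/-! ### Messages, codebooks, and the cross-packet protocol -/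

variable {K : ℕ}

/-- The messages `(m₁, …, m_K)`; the message introduced in round `k` takes `M k` values. -/
abbrev Messages (M : Fin K → ℕ) := (k : Fin K) → Fin (M k)

/-- The concatenated messages `(m₁, …, m_k)` that are encoded in round `k`. -/
abbrev Prefix (M : Fin K → ℕ) (k : Fin K) := (l : {l : Fin K // l ≤ k}) → Fin (M l)

def Messages.upTo {M : Fin K → ℕ} (m : Messages M) (k : Fin K) : Prefix M k := fun l => m l

def Prefix.upTo {M : Fin K → ℕ} {k : Fin K} (m : Prefix M k) (j : {j : Fin K // j ≤ k}) :
    Prefix M j := fun l => m ⟨l, l.2.trans j.2⟩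

/-- The codewords: in round `k` the concatenated message `(m₁, …, m_k)` is encoded into
`N k` symbols. -/
abbrev Codebook (M N : Fin K → ℕ) := (k : Fin K) → Prefix M k → Fin (N k) → ℂ

/-- The signals (sent, received, noise) of all rounds; round `k` has `N k` symbols. -/
abbrev Signal (N : Fin K → ℕ) := (k : Fin K) → Fin (N k) → ℂ

/-- The signals received in all rounds when `m` is sent. -/
def receivedAll {M N : Fin K → ℕ} (P : Fin K → ℝ) (h : Fin K → ℂ) (c : Codebook M N)
    (m : Messages M) (z : Signal N) : Signal N :=
  fun k => received (P k) (h k) (c k (m.upTo k)) (z k)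

/-- White complex Gaussian noise of variance `σ ^ 2` in all rounds. -/
def noiseLaw (σ : ℝ) (N : Fin K → ℕ) : Measure (Signal N) :=
  Measure.pi fun k => Measure.pi fun _ : Fin (N k) => complexGaussian (σ ^ 2)

/-- Gaussian random codebook: all symbols of all codewords are i.i.d. complex Gaussian of unit
variance. -/
def gaussianCodebook (M N : Fin K → ℕ) : Measure (Codebook M N) :=
  Measure.pi fun k => Measure.pi fun _ : Prefix M k =>
    Measure.pi fun _ : Fin (N k) => complexGaussian 1

/-- The random codebook, uniformly distributed messages and the noise, all independent. -/
def experiment (σ : ℝ) (M N : Fin K → ℕ) : Measure (Codebook M N × Messages M × Signal N) :=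
  (gaussianCodebook M N).prod
    ((uniformOn (Set.univ : Set (Messages M))).prod (noiseLaw σ N))

/-- After round `k`, the candidate `(m₁, …, m_k)` is jointly typical with the received signal in
every round `j ≤ k`. -/
def Candidate {M N : Fin K → ℕ} (P : Fin K → ℝ) (σ : ℝ) (h : Fin K → ℂ) (ε : ℝ)
    (c : Codebook M N) (y : Signal N) (k : Fin K) (m : Prefix M k) : Prop :=
  ∀ j : {j : Fin K // j ≤ k}, JointlyTypical (P j) σ (h j) ε (c j (m.upTo j)) (y j)

open Classical in
/-- Joint-typicality decoding after round `k`, based on the signals of rounds `1, …, k`: the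
decoder returns the only candidate, if there is exactly one, and otherwise declares an error. -/
def typicalDecode {M N : Fin K → ℕ} (P : Fin K → ℝ) (σ : ℝ) (h : Fin K → ℂ) (ε : ℝ)
    (c : Codebook M N) (y : Signal N) (k : Fin K) : Option (Prefix M k) :=
  if hm : ∃! m : Prefix M k, Candidate P σ h ε c y k m then some hm.choose else none

/-- After round `k` the joint-typicality decoder does not return the messages sent. -/
def FailsAt {M N : Fin K → ℕ} (P : Fin K → ℝ) (σ : ℝ) (h : Fin K → ℂ) (ε : ℝ) (k : Fin K)
    (e : Codebook M N × Messages M × Signal N) : Prop :=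
  typicalDecode P σ h ε e.1 (receivedAll P h e.1 e.2.1 e.2.2) k ≠ some (e.2.1.upTo k)

/-- Block lengths at scale `n`. -/
def blockLength (N : Fin K → ℕ) (n : ℕ) : Fin K → ℕ := fun k => n * N k

/-- Numbers of message values at scale `n`, for `n (b k - δ)` information bits in round `k`. -/
def numMessages (b : Fin K → ℝ) (δ : ℝ) (n : ℕ) : Fin K → ℕ :=
  fun k => ⌈(2 : ℝ) ^ ((n : ℝ) * (b k - δ))⌉₊

/-! ### Codes and maximal probability of error -/

/-- An HARQ code: encoders for all rounds, of average symbol power at most `1`, and a decoder of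
all the messages from all the rounds. -/
structure HarqCode (M N : Fin K → ℕ) where
  enc : Codebook M N
  dec : Signal N → Messages M
  power_le : ∀ k m, ∑ i, ‖enc k m i‖ ^ 2 ≤ N k
  measurable_dec : Measurable dec

/-- Maximal probability of error over all the messages, in channel state `h`. -/
def HarqCode.maxError {M N : Fin K → ℕ} (c : HarqCode M N) (P : Fin K → ℝ) (σ : ℝ)
    (h : Fin K → ℂ) : ℝ :=
  ⨆ m : Messages M, (noiseLaw σ N).real {z | c.dec (receivedAll P h c.enc m z) ≠ m}

/-! ### Outage -/

/-- Probability that decoding fails in all `K` rounds, over the fading `h` (under `μ`), the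
Gaussian codebook, the messages and the noise. -/
def failureProb {Ω : Type*} [MeasurableSpace Ω] (μ : Measure Ω) (h : Ω → Fin K → ℂ)
    (P : Fin K → ℝ) (σ : ℝ) (M N : Fin K → ℕ) (ε : ℝ) : ℝ :=
  (μ.prod (experiment σ M N)).real {q | ∀ k, FailsAt P σ (h q.1) ε k q.2}

/-- `p` is the outage probability after `K` rounds: the limit of the probability that decoding
fails in all rounds, as the scale `n` of the block lengths tends to infinity, then the
typicality tolerance `ε` to zero, then the back-off `δ` of the rates to zero. -/
def IsOutageProb {Ω : Type*} [MeasurableSpace Ω] (μ : Measure Ω) (h : Ω → Fin K → ℂ)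
    (P : Fin K → ℝ) (σ : ℝ) (b : Fin K → ℝ) (N : Fin K → ℕ) (p : ℝ) : Prop :=
  ∀ η > 0, ∀ᶠ δ in 𝓝[>] (0 : ℝ), ∀ᶠ ε in 𝓝[>] (0 : ℝ), ∀ᶠ n : ℕ in atTop,
    |failureProb μ h P σ (numMessages b δ n) (blockLength N n) ε - p| < η

end XPHARQ

end

namespace XPHARQ

/-! ### Complex Gaussian laws -/

/-! Everything rests on one function, the likelihood ratio of a block (`blockRatio`): the density of
the joint law of input and output relative to the product of its marginals. Bayes' rule gives it in
closed form and shows that it averages to 1 over the input for every fixed output. Its logarithm is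
`n log (1 + snr)` plus the difference of the normalised output and noise energies. Taking
expectations cancels the energies, which yields the mutual information; on jointly typical blocks
the energies are pinned down, so the ratio is `2 ^ (n (log₂ (1 + snr) ± 3 ε))`.

This estimate is used in both directions. Its lower half shows that an independent codeword looks
typical with probability at most about `2 ^ (-I)` (`measure_jointlyTypical_le`), while Chebyshev's
inequality makes the transmitted codeword typical. Its upper half gives the converse: changing
measure to an output law that does not depend on the messages, the decoding regions overlap only
through messages not yet to be decoded, so success is rare once the accumulated rate exceeds the
accumulated information (`experiment_not_failsAt_le`).

Wrong prefixes are classified by the first round `j` in which they differ from the truth. Before `j`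
they share the transmitted codewords; from `j` to `k` all their codewords are independent of the
transmitted ones. Hence decoding after round `k` works if, for each `j ≤ k`, the rates of rounds `j,
…, k` sum to at most the information of these rounds (`experiment_failsAt_le_directError`). In the
first round where the accumulated information suffices, all these suffix conditions hold
automatically (`exists_sum_Icc_le`). That is why only prefix sums enter the outage event. All bounds
are uniform in the channel state, so they integrate over the fading, and continuity from below
removes the margin needed by the converse.

Codes with small maximal error come from a good codebook by expurgation that respects causality,
followed by a slight reduction of power (`exists_harqCode_two`). -/

theorem gaussDensity_pos {v : ℝ} (hv : 0 < v) (z : ℂ) : 0 < gaussDensity v z := by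
  unfold gaussDensity
  positivity

@[fun_prop]
theorem measurable_gaussDensity (v : ℝ) : Measurable (gaussDensity v) := by
  unfold gaussDensity
  fun_prop

/-- The squared modulus is exponentially distributed with mean `v`. The cases `k = 0, 1, 2` give the
normalisation, the mean energy and the variance of the energy. -/
theorem integral_norm_pow_mul_gaussDensity {v : ℝ} (hv : 0 < v) (k : ℕ) :
    ∫ z : ℂ, ‖z‖ ^ (2 * k) * gaussDensity v z = v ^ k * k.factorial := by
  have h := Complex.integral_rpow_mul_exp_neg_mul_rpow (p := 2) (q := ((2 * k : ℕ) : ℝ))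
    (b := v⁻¹) (by norm_num) (by have : (0 : ℝ) ≤ ((2 * k : ℕ) : ℝ) := by positivity
                                 linarith) (by positivity)
  have e1 : -((((2 * k : ℕ) : ℝ)) + 2) / 2 = -(((k + 1 : ℕ) : ℝ)) := by push_cast; ring
  have e2 : ((((2 * k : ℕ) : ℝ)) + 2) / 2 = (k : ℝ) + 1 := by push_cast; ring
  rw [e1, e2, Real.Gamma_nat_eq_factorial, Real.inv_rpow hv.le, Real.rpow_neg hv.le,
    inv_inv, Real.rpow_natCast] at h
  have e3 : ∀ z : ℂ, ‖z‖ ^ (2 * k) * gaussDensity v z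
      = (Real.pi * v)⁻¹ * (‖z‖ ^ (((2 * k : ℕ) : ℝ)) * Real.exp (-v⁻¹ * ‖z‖ ^ (2 : ℝ))) := by
    intro z
    rw [Real.rpow_natCast, Real.rpow_two, gaussDensity]
    have : -(‖z‖ ^ 2) / v = -v⁻¹ * ‖z‖ ^ 2 := by ring
    rw [this]; ring
  simp_rw [e3]
  rw [integral_const_mul, h]
  have := Real.pi_pos
  field_simp
  ring

theorem integrable_norm_pow_mul_gaussDensity {v : ℝ} (hv : 0 < v) (k : ℕ) :
    Integrable fun z : ℂ => ‖z‖ ^ (2 * k) * gaussDensity v z := by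
  -- A function that is not integrable has integral 0 by convention, whereas this integral is
  -- positive.
  by_contra h
  have := integral_norm_pow_mul_gaussDensity hv k
  rw [integral_undef h] at this
  have h2 : 0 < v ^ k * k.factorial := by positivity
  exact h2.ne this

theorem integrable_gaussDensity {v : ℝ} (hv : 0 < v) : Integrable (gaussDensity v) := by
  simpa using integrable_norm_pow_mul_gaussDensity hv 0

theorem integral_gaussDensity {v : ℝ} (hv : 0 < v) : ∫ z, gaussDensity v z = 1 := by
  simpa using integral_norm_pow_mul_gaussDensity hv 0

theorem lintegral_gaussDensity {v : ℝ} (hv : 0 < v) :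
    ∫⁻ z, ENNReal.ofReal (gaussDensity v z) = 1 := by
  rw [← ofReal_integral_eq_lintegral_ofReal (integrable_gaussDensity hv)
    (Eventually.of_forall fun z => (gaussDensity_pos hv z).le), integral_gaussDensity hv,
    ENNReal.ofReal_one]

theorem isProbabilityMeasure_complexGaussian {v : ℝ} (hv : 0 < v) :
    IsProbabilityMeasure (complexGaussian v) :=
  ⟨by rw [complexGaussian, withDensity_apply _ MeasurableSet.univ, Measure.restrict_univ,
        lintegral_gaussDensity hv]⟩

instance : IsProbabilityMeasure (complexGaussian 1) :=
  isProbabilityMeasure_complexGaussian one_pos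

theorem lintegral_complexGaussian (v : ℝ) {f : ℂ → ℝ≥0∞} (hf : Measurable f) :
    ∫⁻ z, f z ∂complexGaussian v = ∫⁻ z, ENNReal.ofReal (gaussDensity v z) * f z := by
  rw [complexGaussian, lintegral_withDensity_eq_lintegral_mul _ (by fun_prop) hf]
  rfl

theorem integrable_complexGaussian_iff {v : ℝ} (hv : 0 < v) {f : ℂ → ℝ} :
    Integrable f (complexGaussian v) ↔ Integrable fun z => gaussDensity v z * f z := by
  rw [complexGaussian, integrable_withDensity_iff_integrable_smul' (by fun_prop) (by simp)]
  simp_rw [ENNReal.toReal_ofReal (gaussDensity_pos hv _).le, smul_eq_mul]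

theorem integral_complexGaussian {v : ℝ} (hv : 0 < v) (f : ℂ → ℝ) :
    ∫ z, f z ∂complexGaussian v = ∫ z, gaussDensity v z * f z := by
  rw [complexGaussian, integral_withDensity_eq_integral_toReal_smul (by fun_prop) (by simp)]
  simp_rw [ENNReal.toReal_ofReal (gaussDensity_pos hv _).le, smul_eq_mul]

theorem integral_norm_pow_complexGaussian {v : ℝ} (hv : 0 < v) (k : ℕ) :
    ∫ z, ‖z‖ ^ (2 * k) ∂complexGaussian v = v ^ k * k.factorial := by
  rw [integral_complexGaussian hv, ← integral_norm_pow_mul_gaussDensity hv]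
  simp_rw [mul_comm]

theorem integrable_norm_pow_complexGaussian {v : ℝ} (hv : 0 < v) (k : ℕ) :
    Integrable (fun z => ‖z‖ ^ (2 * k)) (complexGaussian v) := by
  rw [integrable_complexGaussian_iff hv]
  simpa only [mul_comm] using integrable_norm_pow_mul_gaussDensity hv k

theorem integral_norm_sq_complexGaussian {v : ℝ} (hv : 0 < v) :
    ∫ z, ‖z‖ ^ 2 ∂complexGaussian v = v := by
  simpa using integral_norm_pow_complexGaussian hv 1

theorem integrable_norm_sq_complexGaussian {v : ℝ} (hv : 0 < v) :
    Integrable (fun z => ‖z‖ ^ 2) (complexGaussian v) := by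
  simpa using integrable_norm_pow_complexGaussian hv 1

theorem memLp_norm_sq_complexGaussian {v : ℝ} (hv : 0 < v) :
    MemLp (fun z => ‖z‖ ^ 2) 2 (complexGaussian v) := by
  rw [memLp_two_iff_integrable_sq (by fun_prop)]
  simpa [← pow_mul] using integrable_norm_pow_complexGaussian hv 2

theorem variance_norm_sq_complexGaussian {v : ℝ} (hv : 0 < v) :
    variance (fun z => ‖z‖ ^ 2) (complexGaussian v) = v ^ 2 := by
  have := isProbabilityMeasure_complexGaussian hv
  rw [variance_eq_sub (memLp_norm_sq_complexGaussian hv), integral_norm_sq_complexGaussian hv]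
  have h := integral_norm_pow_complexGaussian hv 2
  have h2 : ((fun z : ℂ => ‖z‖ ^ 2) ^ 2) = fun z : ℂ => ‖z‖ ^ (2 * 2) := by
    ext z; simp [← pow_mul]
  rw [h2, h]
  norm_num [Nat.factorial]
  ring

/-- The weak law of large numbers for the energy of white complex Gaussian vectors, with an
explicit rate. -/
theorem measureReal_energy_deviation_le {v : ℝ} (hv : 0 < v) {n : ℕ} (hn : 0 < n) {t : ℝ}
    (ht : 0 < t) :
    (Measure.pi fun _ : Fin n => complexGaussian v).real
      {w | t ≤ |(∑ i, ‖w i‖ ^ 2) / (n * v) - 1|} ≤ 1 / (n * t ^ 2) := by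
  have := isProbabilityMeasure_complexGaussian hv
  set μ := Measure.pi fun _ : Fin n => complexGaussian v
  set X : (Fin n → ℂ) → ℝ := fun w => ∑ i, ‖w i‖ ^ 2
  have hX : X = ∑ i, fun w : Fin n → ℂ => ‖w i‖ ^ 2 := by ext w; simp [X]
  have hmem : MemLp X 2 μ := by
    rw [hX]
    exact memLp_finsetSum' _ fun i _ =>
      (memLp_norm_sq_complexGaussian hv).comp_measurePreserving
        (measurePreserving_eval (fun _ : Fin n => complexGaussian v) i)
  have hvar : variance X μ = n * v ^ 2 := by
    rw [hX, variance_sum_pi (X := fun _ : Fin n => fun z : ℂ => ‖z‖ ^ 2)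
      fun _ => memLp_norm_sq_complexGaussian hv]
    simp [variance_norm_sq_complexGaussian hv]
  have hmean : ∫ w, X w ∂μ = n * v := by
    have : ∀ i : Fin n, ∫ w, ‖w i‖ ^ 2 ∂μ = v := fun i => by
      rw [← integral_norm_sq_complexGaussian hv]
      exact integral_comp_eval (μ := fun _ : Fin n => complexGaussian v) (i := i)
        (f := fun z : ℂ => ‖z‖ ^ 2) (by fun_prop)
    simp only [X]
    rw [integral_finsetSum _ fun i _ => integrable_comp_eval
      (μ := fun _ : Fin n => complexGaussian v) (i := i) (integrable_norm_sq_complexGaussian hv)]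
    rw [Finset.sum_congr rfl fun i _ => this i]
    simp
  have hn' : (0 : ℝ) < n := by exact_mod_cast hn
  have hc : 0 < n * v * t := by positivity
  have h := meas_ge_le_variance_div_sq hmem hc
  rw [hmean, hvar] at h
  have hset : {w | t ≤ |X w / (n * v) - 1|} = {w | n * v * t ≤ |X w - n * v|} := by
    ext w
    have : X w - n * v = n * v * (X w / (n * v) - 1) := by field_simp
    simp only [Set.mem_ofPred_eq]
    rw [this, abs_mul, abs_of_pos (by positivity : 0 < n * v)]
    exact (mul_le_mul_iff_right₀ (by positivity)).symm
  rw [hset]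
  refine (ENNReal.toReal_mono ENNReal.ofReal_ne_top h).trans ?_
  rw [ENNReal.toReal_ofReal (by positivity)]
  apply le_of_eq
  field_simp

/-! ### Products of densities -/

theorem lintegral_pi_prod {ι : Type*} [Fintype ι] {α : ι → Type*} [∀ i, MeasurableSpace (α i)]
    (μ : ∀ i, Measure (α i)) [∀ i, IsProbabilityMeasure (μ i)] {f : ∀ i, α i → ℝ≥0∞}
    (hf : ∀ i, Measurable (f i)) :
    ∫⁻ x, ∏ i, f i (x i) ∂Measure.pi μ = ∏ i, ∫⁻ x, f i x ∂μ i := by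
  refine (lintegral_prod_eq_prod_lintegral_of_indepFun Finset.univ
    (fun i (x : ∀ i, α i) => f i (x i))
    (iIndepFun_pi fun i => (hf i).aemeasurable)
    (fun i => (hf i).comp (measurable_pi_apply i))).trans ?_
  refine Finset.prod_congr rfl fun i _ => ?_
  exact (measurePreserving_eval μ i).lintegral_comp (hf i)

theorem pi_withDensity {ι : Type*} [Fintype ι] {α : ι → Type*} [∀ i, MeasurableSpace (α i)]
    (μ : ∀ i, Measure (α i)) [∀ i, IsProbabilityMeasure (μ i)] {f : ∀ i, α i → ℝ≥0∞}
    (hf : ∀ i, Measurable (f i)) [∀ i, SigmaFinite ((μ i).withDensity (f i))] :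
    Measure.pi (fun i => (μ i).withDensity (f i))
      = (Measure.pi μ).withDensity fun x => ∏ i, f i (x i) := by
  refine Measure.pi_eq fun s hs => ?_
  rw [withDensity_apply _ (MeasurableSet.univ_pi hs),
    ← lintegral_indicator (MeasurableSet.univ_pi hs)]
  have : ∀ x : ∀ i, α i, (Set.univ.pi s).indicator (fun x => ∏ i, f i (x i)) x
      = ∏ i, (s i).indicator (f i) (x i) := by
    intro x
    by_cases hx : x ∈ Set.univ.pi s
    · rw [Set.indicator_of_mem hx]
      exact Finset.prod_congr rfl fun i _ => (Set.indicator_of_mem (hx i trivial) _).symm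
    · rw [Set.indicator_of_notMem hx]
      simp only [Set.mem_pi, Set.mem_univ, true_implies, not_forall] at hx
      obtain ⟨i, hi⟩ := hx
      exact (Finset.prod_eq_zero (Finset.mem_univ i) (Set.indicator_of_notMem hi _)).symm
  simp_rw [this]
  rw [lintegral_pi_prod μ fun i => (hf i).indicator (hs i)]
  refine Finset.prod_congr rfl fun i _ => ?_
  rw [withDensity_apply _ (hs i), lintegral_indicator (hs i)]

/-! ### The likelihood ratio of one channel use -/

/-- The joint density of input and output of `y = a x + z`, with noise variance `s`, relative to
the product of its marginals. -/
noncomputable def likelihoodRatio (a : ℂ) (s : ℝ) (x y : ℂ) : ℝ :=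
  (‖a‖ ^ 2 + s) / s * Real.exp (‖y‖ ^ 2 / (‖a‖ ^ 2 + s) - ‖y - a * x‖ ^ 2 / s)

variable {a : ℂ} {s : ℝ}

theorem likelihoodRatio_pos (hs : 0 < s) (x y : ℂ) : 0 < likelihoodRatio a s x y := by
  unfold likelihoodRatio
  positivity

theorem measurable_likelihoodRatio_left (a : ℂ) (s : ℝ) (y : ℂ) :
    Measurable fun x => likelihoodRatio a s x y := by
  unfold likelihoodRatio
  fun_prop

theorem measurable_likelihoodRatio_right (a : ℂ) (s : ℝ) (x : ℂ) :
    Measurable fun y => likelihoodRatio a s x y := by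
  unfold likelihoodRatio
  fun_prop

/-- Bayes' rule: the output density times the ratio is the conditional density of the output given
the input. -/
theorem gaussDensity_mul_likelihoodRatio (hs : 0 < s) (x y : ℂ) :
    gaussDensity (‖a‖ ^ 2 + s) y * likelihoodRatio a s x y = gaussDensity s (y - a * x) := by
  have hv : 0 < ‖a‖ ^ 2 + s := by positivity
  unfold gaussDensity likelihoodRatio
  have := Real.pi_pos
  have h : Real.exp (-(‖y - a * x‖ ^ 2) / s) = Real.exp (-(‖y‖ ^ 2) / (‖a‖ ^ 2 + s)) *
      Real.exp (‖y‖ ^ 2 / (‖a‖ ^ 2 + s) - ‖y - a * x‖ ^ 2 / s) := by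
    rw [← Real.exp_add]; congr 1; ring
  rw [h]
  field_simp

/-- Bayes' rule in the other direction, by completing the square: given `y`, the input is Gaussian
around its linear least-squares estimate, with error variance `s / (‖a‖ ^ 2 + s)`. -/
theorem gaussDensity_one_mul_likelihoodRatio (hs : 0 < s) (x y : ℂ) :
    gaussDensity 1 x * likelihoodRatio a s x y
      = gaussDensity (s / (‖a‖ ^ 2 + s)) (x - (starRingEnd ℂ) a / ((‖a‖ ^ 2 + s : ℝ) : ℂ) * y) := by
  have hv : 0 < ‖a‖ ^ 2 + s := by positivity
  unfold gaussDensity likelihoodRatio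
  have := Real.pi_pos
  have h : Real.exp (-(‖x - (starRingEnd ℂ) a / ((‖a‖ ^ 2 + s : ℝ) : ℂ) * y‖ ^ 2) /
        (s / (‖a‖ ^ 2 + s))) = Real.exp (-(‖x‖ ^ 2) / 1) *
      Real.exp (‖y‖ ^ 2 / (‖a‖ ^ 2 + s) - ‖y - a * x‖ ^ 2 / s) := by
    rw [← Real.exp_add]; congr 1
    have e : x - (starRingEnd ℂ) a / ((‖a‖ ^ 2 + s : ℝ) : ℂ) * y
        = (((‖a‖ ^ 2 + s)⁻¹ : ℝ) : ℂ) *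
          (((‖a‖ ^ 2 + s : ℝ) : ℂ) * x - (starRingEnd ℂ) a * y) := by
      have : ((‖a‖ ^ 2 + s : ℝ) : ℂ) ≠ 0 := by exact_mod_cast hv.ne'
      push_cast at this ⊢
      field_simp
    rw [e, norm_mul, mul_pow, Complex.norm_real, Real.norm_eq_abs, sq_abs]
    generalize hV : ‖a‖ ^ 2 + s = v at *
    have hs' : s = v - ‖a‖ ^ 2 := by linarith
    have e2 : ‖(v : ℂ) * x - (starRingEnd ℂ) a * y‖ ^ 2 * s
        = s * v * (s * ‖x‖ ^ 2 - s / v * ‖y‖ ^ 2 + ‖y - a * x‖ ^ 2) := by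
      have h3 : s / v * v = s := by field_simp
      have h4 : s * v * (s * ‖x‖ ^ 2 - s / v * ‖y‖ ^ 2 + ‖y - a * x‖ ^ 2)
        = s * v * s * ‖x‖ ^ 2 - s * (s / v * v) * ‖y‖ ^ 2 + s * v * ‖y - a * x‖ ^ 2 := by ring
      rw [h4, h3, hs']
      simp only [Complex.sq_norm, Complex.normSq_apply, Complex.sub_re, Complex.sub_im,
        Complex.mul_re, Complex.mul_im, Complex.conj_re, Complex.conj_im, Complex.ofReal_re,
        Complex.ofReal_im]
      ring
    have e3 : ‖(v : ℂ) * x - (starRingEnd ℂ) a * y‖ ^ 2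
        = v * (s * ‖x‖ ^ 2 - s / v * ‖y‖ ^ 2 + ‖y - a * x‖ ^ 2) := by
      apply mul_right_cancel₀ hs.ne'
      rw [e2]; ring
    rw [e3]
    field_simp
    ring
  rw [h]
  field_simp

/-- The integrand is the posterior density of the input given `y`, whose total mass is 1 for every
single `y`. -/
theorem lintegral_likelihoodRatio (hs : 0 < s) (y : ℂ) :
    ∫⁻ x, ENNReal.ofReal (likelihoodRatio a s x y) ∂complexGaussian 1 = 1 := by
  have hv : 0 < ‖a‖ ^ 2 + s := by positivity
  rw [lintegral_complexGaussian _ (measurable_likelihoodRatio_left a s y).ennreal_ofReal]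
  simp_rw [← ENNReal.ofReal_mul (gaussDensity_pos one_pos _).le,
    gaussDensity_one_mul_likelihoodRatio hs]
  rw [lintegral_sub_right_eq_self (μ := volume)
    (fun x => ENNReal.ofReal (gaussDensity (s / (‖a‖ ^ 2 + s)) x))]
  exact lintegral_gaussDensity (by positivity)

/-- Conditioned on the input, the output of a channel use has density `likelihoodRatio` with
respect to the output law. -/
theorem map_add_complexGaussian (hs : 0 < s) (x : ℂ) :
    (complexGaussian s).map (fun z => a * x + z)
      = (complexGaussian (‖a‖ ^ 2 + s)).withDensity
        fun y => ENNReal.ofReal (likelihoodRatio a s x y) := by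
  have hv : 0 < ‖a‖ ^ 2 + s := by positivity
  ext B hB
  rw [withDensity_apply _ hB, ← lintegral_indicator hB,
    lintegral_complexGaussian _ ((measurable_likelihoodRatio_right a s x).ennreal_ofReal.indicator hB),
    ← lintegral_indicator_one hB, lintegral_map (measurable_one.indicator hB) (by fun_prop),
    lintegral_complexGaussian s (f := fun z => B.indicator 1 (a * x + z))
      ((measurable_one.indicator hB).comp (by fun_prop)),
    ← lintegral_add_left_eq_self (μ := volume) (fun z => ENNReal.ofReal
      (gaussDensity (‖a‖ ^ 2 + s) z) * _) (a * x)]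
  refine lintegral_congr fun z => ?_
  by_cases hz : a * x + z ∈ B
  · rw [Set.indicator_of_mem hz, Set.indicator_of_mem hz,
      ← ENNReal.ofReal_mul (gaussDensity_pos hv _).le, gaussDensity_mul_likelihoodRatio hs]
    simp
  · simp [Set.indicator_of_notMem hz]

end XPHARQ

namespace XPHARQ

/-! ### One block of channel uses -/

/-- The amplitude by which the channel multiplies the input. -/
noncomputable def gain (P : ℝ) (h : ℂ) : ℂ := ((Real.sqrt P : ℝ) : ℂ) * h

theorem norm_gain_sq {P : ℝ} (hP : 0 ≤ P) (h : ℂ) : ‖gain P h‖ ^ 2 = P * ‖h‖ ^ 2 := by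
  rw [gain, norm_mul, mul_pow, Complex.norm_real, Real.norm_eq_abs, sq_abs, Real.sq_sqrt hP]

theorem one_add_snr {P σ : ℝ} (hP : 0 ≤ P) (hσ : 0 < σ) (h : ℂ) :
    1 + snr P σ h = (‖gain P h‖ ^ 2 + σ ^ 2) / σ ^ 2 := by
  rw [norm_gain_sq hP, snr]
  field_simp
  ring

theorem snr_nonneg {P : ℝ} (hP : 0 ≤ P) (σ : ℝ) (h : ℂ) : 0 ≤ snr P σ h := by
  unfold snr
  positivity

theorem outputDensity_eq {P : ℝ} (hP : 0 ≤ P) (σ : ℝ) (h : ℂ) :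
    outputDensity P σ h = gaussDensity (‖gain P h‖ ^ 2 + σ ^ 2) := by
  rw [norm_gain_sq hP]
  rfl

theorem received_apply {n : ℕ} (P : ℝ) (h : ℂ) (x z : Fin n → ℂ) (i : Fin n) :
    received P h x z i = gain P h * x i + z i := rfl

@[fun_prop]
theorem measurable_received {n : ℕ} (P : ℝ) (h : ℂ) :
    Measurable fun q : (Fin n → ℂ) × (Fin n → ℂ) => received P h q.1 q.2 := by
  unfold received
  fun_prop

theorem measurable_received_right {n : ℕ} (P : ℝ) (h : ℂ) (x : Fin n → ℂ) :
    Measurable (received P h x) := by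
  unfold received
  fun_prop

/-- The likelihood ratio of a block. -/
noncomputable def blockRatio {n : ℕ} (P σ : ℝ) (h : ℂ) (x y : Fin n → ℂ) : ℝ :=
  ∏ i, likelihoodRatio (gain P h) (σ ^ 2) (x i) (y i)

section Block

variable {n : ℕ} {P σ : ℝ} {h : ℂ}

theorem blockRatio_pos (hσ : 0 < σ) (x y : Fin n → ℂ) : 0 < blockRatio P σ h x y :=
  Finset.prod_pos fun _ _ => likelihoodRatio_pos (by positivity) _ _

theorem measurable_blockRatio :
    Measurable fun q : (Fin n → ℂ) × (Fin n → ℂ) => blockRatio P σ h q.1 q.2 := by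
  unfold blockRatio likelihoodRatio
  fun_prop

theorem ofReal_blockRatio (hσ : 0 < σ) (x y : Fin n → ℂ) :
    ENNReal.ofReal (blockRatio P σ h x y)
      = ∏ i, ENNReal.ofReal (likelihoodRatio (gain P h) (σ ^ 2) (x i) (y i)) :=
  ENNReal.ofReal_prod_of_nonneg fun _ _ => (likelihoodRatio_pos (by positivity) _ _).le

theorem lintegral_blockRatio (hσ : 0 < σ) (y : Fin n → ℂ) :
    ∫⁻ x, ENNReal.ofReal (blockRatio P σ h x y) ∂(Measure.pi fun _ => complexGaussian 1) = 1 := by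
  simp_rw [ofReal_blockRatio hσ]
  rw [lintegral_pi_prod (fun _ : Fin n => complexGaussian 1)
    (f := fun i x => ENNReal.ofReal (likelihoodRatio (gain P h) (σ ^ 2) x (y i)))
    fun i => (measurable_likelihoodRatio_left _ _ _).ennreal_ofReal]
  simp [lintegral_likelihoodRatio (by positivity : 0 < σ ^ 2)]

/-- The law of a block of outputs. -/
noncomputable def outputLaw (n : ℕ) (P σ : ℝ) (h : ℂ) : Measure (Fin n → ℂ) :=
  Measure.pi fun _ => complexGaussian (‖gain P h‖ ^ 2 + σ ^ 2)

theorem isProbabilityMeasure_noise (hσ : 0 < σ) :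
    IsProbabilityMeasure (complexGaussian (σ ^ 2)) :=
  isProbabilityMeasure_complexGaussian (by positivity)

theorem isProbabilityMeasure_outputLaw (hσ : 0 < σ) :
    IsProbabilityMeasure (outputLaw n P σ h) := by
  have := isProbabilityMeasure_complexGaussian
    (by positivity : 0 < ‖gain P h‖ ^ 2 + σ ^ 2)
  unfold outputLaw
  infer_instance

theorem map_received (hσ : 0 < σ) (x : Fin n → ℂ) :
    (Measure.pi fun _ : Fin n => complexGaussian (σ ^ 2)).map (received P h x)
      = (outputLaw n P σ h).withDensity fun y => ENNReal.ofReal (blockRatio P σ h x y) := by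
  have := isProbabilityMeasure_noise hσ
  have := isProbabilityMeasure_complexGaussian
    (by positivity : 0 < ‖gain P h‖ ^ 2 + σ ^ 2)
  have hs : 0 < σ ^ 2 := by positivity
  have key : ∀ i, (complexGaussian (σ ^ 2)).map (fun z => gain P h * x i + z)
      = (complexGaussian (‖gain P h‖ ^ 2 + σ ^ 2)).withDensity fun y =>
        ENNReal.ofReal (likelihoodRatio (gain P h) (σ ^ 2) (x i) y) :=
    fun i => map_add_complexGaussian hs (x i)
  have hprob : ∀ i, IsProbabilityMeasure
      ((complexGaussian (σ ^ 2)).map (fun z => gain P h * x i + z)) :=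
    fun i => Measure.isProbabilityMeasure_map (by fun_prop)
  have h1 : (Measure.pi fun _ : Fin n => complexGaussian (σ ^ 2)).map (received P h x)
      = Measure.pi fun i => (complexGaussian (σ ^ 2)).map (fun z => gain P h * x i + z) :=
    Measure.pi_map_pi (f := fun i z => gain P h * x i + z) fun i => by fun_prop
  have : ∀ i, SigmaFinite ((complexGaussian (‖gain P h‖ ^ 2 + σ ^ 2)).withDensity fun y =>
        ENNReal.ofReal (likelihoodRatio (gain P h) (σ ^ 2) (x i) y)) := fun i => by
    rw [← key i]; infer_instance
  rw [h1]
  simp_rw [key]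
  rw [pi_withDensity (fun _ : Fin n => complexGaussian (‖gain P h‖ ^ 2 + σ ^ 2))
    (f := fun i y => ENNReal.ofReal (likelihoodRatio (gain P h) (σ ^ 2) (x i) y))
    fun i => (measurable_likelihoodRatio_right _ _ _).ennreal_ofReal]
  simp_rw [ofReal_blockRatio hσ]
  rfl

theorem inputOutputLaw_eq_withDensity (hσ : 0 < σ) :
    inputOutputLaw n P σ h
      = ((Measure.pi fun _ : Fin n => complexGaussian 1).prod (outputLaw n P σ h)).withDensity
        fun q => ENNReal.ofReal (blockRatio P σ h q.1 q.2) := by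
  have := isProbabilityMeasure_noise hσ
  have := isProbabilityMeasure_outputLaw (n := n) (P := P) (h := h) hσ
  have hm : Measurable fun q : (Fin n → ℂ) × (Fin n → ℂ) => (q.1, received P h q.1 q.2) := by
    fun_prop
  ext B hB
  rw [withDensity_apply _ hB, ← lintegral_indicator hB, inputOutputLaw, Measure.map_apply hm hB,
    Measure.prod_apply (hm hB),
    lintegral_prod _ (measurable_blockRatio.ennreal_ofReal.indicator hB).aemeasurable]
  refine lintegral_congr fun x => ?_
  have hBx : MeasurableSet (Prod.mk x ⁻¹' B) := measurable_prodMk_left hB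
  have : (Prod.mk x ⁻¹' ((fun q : (Fin n → ℂ) × (Fin n → ℂ) => (q.1, received P h q.1 q.2)) ⁻¹' B))
      = received P h x ⁻¹' (Prod.mk x ⁻¹' B) := rfl
  rw [this, ← Measure.map_apply (measurable_received_right P h x) hBx,
    map_received hσ, withDensity_apply _ hBx, ← lintegral_indicator hBx]
  rfl

theorem isProbabilityMeasure_inputOutputLaw (hσ : 0 < σ) :
    IsProbabilityMeasure (inputOutputLaw n P σ h) := by
  have := isProbabilityMeasure_noise hσ
  exact Measure.isProbabilityMeasure_map (by fun_prop)

theorem inputOutputLaw_fst (hσ : 0 < σ) :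
    (inputOutputLaw n P σ h).fst = Measure.pi fun _ : Fin n => complexGaussian 1 := by
  have := isProbabilityMeasure_noise hσ
  rw [Measure.fst, inputOutputLaw, Measure.map_map measurable_fst (by fun_prop)]
  exact Measure.fst_prod

/-- Averaging the ratio over the input gives 1, so the output law is read off from the density; no
convolution of Gaussians is computed. -/
theorem inputOutputLaw_snd (hσ : 0 < σ) :
    (inputOutputLaw n P σ h).snd = outputLaw n P σ h := by
  have := isProbabilityMeasure_outputLaw (n := n) (P := P) (h := h) hσ
  ext B hB
  rw [Measure.snd_apply hB, inputOutputLaw_eq_withDensity hσ,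
    withDensity_apply _ (measurable_snd hB), ← lintegral_indicator (measurable_snd hB),
    lintegral_prod_symm _
      (measurable_blockRatio.ennreal_ofReal.indicator (measurable_snd hB)).aemeasurable,
    ← lintegral_indicator_one hB]
  refine lintegral_congr fun y => ?_
  by_cases hy : y ∈ B
  · rw [Set.indicator_of_mem hy, Pi.one_apply, ← lintegral_blockRatio (P := P) (h := h) hσ y]
    exact lintegral_congr fun x => Set.indicator_of_mem (by exact hy) _
  · rw [Set.indicator_of_notMem hy, ← lintegral_zero (α := Fin n → ℂ)]
    exact lintegral_congr fun x => Set.indicator_of_notMem (by exact hy) _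

/-! ### Differential entropies and typical sequences -/

theorem logb_gaussDensity {v : ℝ} (hv : 0 < v) (z : ℂ) :
    Real.logb 2 (gaussDensity v z) = -(Real.log (Real.pi * v) + ‖z‖ ^ 2 / v) / Real.log 2 := by
  have := Real.pi_pos
  rw [Real.logb, gaussDensity, Real.log_mul (by positivity) (Real.exp_ne_zero _), Real.log_exp,
    Real.log_inv]
  ring

theorem gaussDensity_mul_logb {v : ℝ} (hv : 0 < v) (z : ℂ) :
    gaussDensity v z * Real.logb 2 (gaussDensity v z)
      = -(Real.log (Real.pi * v) / Real.log 2) * gaussDensity v z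
        + -(1 / (v * Real.log 2)) * (‖z‖ ^ 2 * gaussDensity v z) := by
  have := Real.log_pos one_lt_two
  rw [logb_gaussDensity hv]
  field_simp
  ring

theorem integrable_gaussDensity_mul_logb {v : ℝ} (hv : 0 < v) :
    Integrable fun z : ℂ => gaussDensity v z * Real.logb 2 (gaussDensity v z) := by
  simp_rw [gaussDensity_mul_logb hv]
  have h1 := integrable_norm_pow_mul_gaussDensity hv 1
  rw [mul_one] at h1
  exact ((integrable_gaussDensity hv).const_mul _).add (h1.const_mul _)

theorem diffEntropy_gaussDensity {v : ℝ} (hv : 0 < v) :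
    diffEntropy (gaussDensity v) = (Real.log (Real.pi * v) + 1) / Real.log 2 := by
  have := Real.log_pos one_lt_two
  have h1 := integrable_norm_pow_mul_gaussDensity hv 1
  have h2 := integral_norm_pow_mul_gaussDensity hv 1
  simp only [mul_one, pow_one, Nat.factorial_one, Nat.cast_one] at h1 h2
  unfold diffEntropy
  simp_rw [gaussDensity_mul_logb hv]
  rw [integral_add ((integrable_gaussDensity hv).const_mul _) (h1.const_mul _),
    integral_const_mul, integral_const_mul, integral_gaussDensity hv, h2]
  field_simp
  ring

/-- The change of variables from (input, noise) to (input, output), which turns the joint entropy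
into the sum of the entropies of input and noise. -/
theorem measurePreserving_shear (a : ℂ) :
    MeasurePreserving (fun q : ℂ × ℂ => (q.1, a * q.1 + q.2)) := by
  refine (MeasurePreserving.id (volume : Measure ℂ)).skew_product
    (g := fun x z => a * x + z) (by fun_prop) (Eventually.of_forall fun x => ?_)
  exact (measurePreserving_add_left volume (a * x)).map_eq

theorem jointDensity_apply (P σ : ℝ) (h : ℂ) (q : ℂ × ℂ) :
    jointDensity P σ h q = gaussDensity 1 q.1 * gaussDensity (σ ^ 2) (q.2 - gain P h * q.1) := rfl

@[fun_prop]
theorem measurable_jointDensity (P σ : ℝ) (h : ℂ) : Measurable (jointDensity P σ h) := by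
  unfold jointDensity
  fun_prop

theorem diffEntropy_jointDensity (hσ : 0 < σ) :
    diffEntropy (jointDensity P σ h)
      = diffEntropy (gaussDensity 1) + diffEntropy (gaussDensity (σ ^ 2)) := by
  have hs : 0 < σ ^ 2 := by positivity
  have hmp := measurePreserving_shear (gain P h)
  have hmeas : Measurable fun q => jointDensity P σ h q * Real.logb 2 (jointDensity P σ h q) := by
    unfold Real.logb
    fun_prop
  unfold diffEntropy
  rw [← neg_add, ← hmp.map_eq, integral_map hmp.measurable.aemeasurable
    hmeas.aestronglyMeasurable]
  have e : ∀ q : ℂ × ℂ, jointDensity P σ h (q.1, gain P h * q.1 + q.2) *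
        Real.logb 2 (jointDensity P σ h (q.1, gain P h * q.1 + q.2))
      = (gaussDensity 1 q.1 * Real.logb 2 (gaussDensity 1 q.1)) * gaussDensity (σ ^ 2) q.2
        + gaussDensity 1 q.1 *
          (gaussDensity (σ ^ 2) q.2 * Real.logb 2 (gaussDensity (σ ^ 2) q.2)) := by
    intro q
    rw [jointDensity_apply]
    simp only [add_sub_cancel_left]
    rw [Real.logb_mul (gaussDensity_pos one_pos _).ne' (gaussDensity_pos hs _).ne']
    ring
  simp_rw [e]
  rw [integral_add]
  · rw [show (volume : Measure (ℂ × ℂ)) = volume.prod volume from rfl,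
      integral_prod_mul (fun x => gaussDensity 1 x * Real.logb 2 (gaussDensity 1 x))
        (gaussDensity (σ ^ 2)),
      integral_prod_mul (gaussDensity 1)
        (fun z => gaussDensity (σ ^ 2) z * Real.logb 2 (gaussDensity (σ ^ 2) z)),
      integral_gaussDensity one_pos, integral_gaussDensity hs, mul_one, one_mul]
  · exact (integrable_gaussDensity_mul_logb one_pos).mul_prod (integrable_gaussDensity hs)
  · exact (integrable_gaussDensity one_pos).mul_prod (integrable_gaussDensity_mul_logb hs)

theorem sum_logb_gaussDensity {v : ℝ} (hv : 0 < v) (w : Fin n → ℂ) :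
    ∑ i, Real.logb 2 (gaussDensity v (w i))
      = -(n * Real.log (Real.pi * v) + (∑ i, ‖w i‖ ^ 2) / v) / Real.log 2 := by
  simp_rw [logb_gaussDensity hv]
  rw [← Finset.sum_div, Finset.sum_neg_distrib, Finset.sum_add_distrib, ← Finset.sum_div]
  simp

/-- The logarithm of a Gaussian density is affine in the energy, so typicality only says that the
normalised energy is close to 1. The factor `Real.log 2` converts bits to nats. -/
theorem typical_gaussDensity_iff {v : ℝ} (hv : 0 < v) (hn : 0 < n) {ε : ℝ} {w : Fin n → ℂ} :
    Typical ε (gaussDensity v) w ↔ |(∑ i, ‖w i‖ ^ 2) / (n * v) - 1| < ε * Real.log 2 := by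
  have hl := Real.log_pos one_lt_two
  have hn' : (0 : ℝ) < n := by exact_mod_cast hn
  unfold Typical
  rw [Real.logb_prod _ _ fun i _ => (gaussDensity_pos hv _).ne', diffEntropy_gaussDensity hv,
    sum_logb_gaussDensity hv, ← div_lt_iff₀ hl]
  rw [show ∀ B : ℝ, |B| / Real.log 2 = |B / Real.log 2| from fun B => by
    rw [abs_div, abs_of_pos hl]]
  congr! 2
  field_simp
  ring

theorem typical_jointDensity_iff (hσ : 0 < σ) (hn : 0 < n) {ε : ℝ} {x y : Fin n → ℂ} :
    Typical ε (jointDensity P σ h) (fun i => (x i, y i)) ↔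
      |(∑ i, ‖x i‖ ^ 2) / n + (∑ i, ‖y i - gain P h * x i‖ ^ 2) / (n * σ ^ 2) - 2|
        < ε * Real.log 2 := by
  have hl := Real.log_pos one_lt_two
  have hn' : (0 : ℝ) < n := by exact_mod_cast hn
  have hs : 0 < σ ^ 2 := by positivity
  unfold Typical
  simp_rw [jointDensity_apply]
  rw [Finset.prod_mul_distrib, Real.logb_mul
      (Finset.prod_ne_zero_iff.2 fun i _ => (gaussDensity_pos one_pos _).ne')
      (Finset.prod_ne_zero_iff.2 fun i _ => (gaussDensity_pos hs _).ne'),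
    Real.logb_prod _ _ fun i _ => (gaussDensity_pos one_pos _).ne',
    Real.logb_prod _ _ fun i _ => (gaussDensity_pos hs _).ne', diffEntropy_jointDensity hσ,
    diffEntropy_gaussDensity one_pos, diffEntropy_gaussDensity hs,
    sum_logb_gaussDensity one_pos, sum_logb_gaussDensity hs (fun i => y i - gain P h * x i),
    ← div_lt_iff₀ hl]
  rw [show ∀ B : ℝ, |B| / Real.log 2 = |B / Real.log 2| from fun B => by
    rw [abs_div, abs_of_pos hl]]
  congr! 2
  field_simp
  ring

/-! ### Jointly typical blocks -/

/-- The deviation is the normalised output energy minus the normalised noise energy. The latter is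
controlled only as the difference of the joint and the input conditions, so all three typicality
conditions are spent, each costing `ε`. -/
theorem abs_log_blockRatio_sub_le (hP : 0 ≤ P) (hσ : 0 < σ) (hn : 0 < n) {ε : ℝ}
    {x y : Fin n → ℂ} (hxy : JointlyTypical P σ h ε x y) :
    |Real.logb 2 (blockRatio P σ h x y) - n * Real.logb 2 (1 + snr P σ h)| ≤ n * (3 * ε) := by
  have hl := Real.log_pos one_lt_two
  have hn' : (0 : ℝ) < n := by exact_mod_cast hn
  have hs : 0 < σ ^ 2 := by positivity
  obtain ⟨h1, h2, h3⟩ := hxy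
  rw [typical_gaussDensity_iff one_pos hn, mul_one] at h1
  rw [outputDensity_eq hP, typical_gaussDensity_iff (by positivity) hn] at h2
  rw [typical_jointDensity_iff hσ hn] at h3
  rw [one_add_snr hP hσ]
  set v := ‖gain P h‖ ^ 2 + σ ^ 2 with hv
  have hv0 : 0 < v := by positivity
  have e : Real.logb 2 (blockRatio P σ h x y) = n * Real.logb 2 (v / σ ^ 2) +
      n * ((∑ i, ‖y i‖ ^ 2) / (n * v) - (∑ i, ‖y i - gain P h * x i‖ ^ 2) / (n * σ ^ 2))
        / Real.log 2 := by
    have : ∀ i, Real.logb 2 (likelihoodRatio (gain P h) (σ ^ 2) (x i) (y i))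
        = Real.logb 2 (v / σ ^ 2)
          + (‖y i‖ ^ 2 / v - ‖y i - gain P h * x i‖ ^ 2 / σ ^ 2) / Real.log 2 := by
      intro i
      rw [likelihoodRatio, ← hv, Real.logb_mul (by positivity) (Real.exp_ne_zero _), Real.logb,
        Real.logb, Real.log_exp]
    rw [blockRatio, Real.logb_prod _ _ fun i _ => (likelihoodRatio_pos hs _ _).ne']
    simp_rw [this]
    rw [Finset.sum_add_distrib, ← Finset.sum_div, Finset.sum_sub_distrib, ← Finset.sum_div,
      ← Finset.sum_div]
    simp only [Finset.sum_const, Finset.card_univ, Fintype.card_fin, nsmul_eq_mul]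
    field_simp
  rw [e, add_sub_cancel_left, mul_div_assoc, abs_mul, abs_of_pos hn', abs_div, abs_of_pos hl]
  refine mul_le_mul_of_nonneg_left ?_ hn'.le
  rw [div_le_iff₀ hl, abs_le]
  rw [abs_lt] at h1 h2 h3
  constructor <;> linarith [h1.1, h1.2, h2.1, h2.2, h3.1, h3.2]

theorem blockRatio_le (hP : 0 ≤ P) (hσ : 0 < σ) (hn : 0 < n) {ε : ℝ} {x y : Fin n → ℂ}
    (hxy : JointlyTypical P σ h ε x y) :
    blockRatio P σ h x y ≤ 2 ^ (n * (Real.logb 2 (1 + snr P σ h) + 3 * ε)) := by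
  rw [← Real.logb_le_iff_le_rpow one_lt_two (blockRatio_pos hσ _ _)]
  linarith [(abs_le.1 (abs_log_blockRatio_sub_le hP hσ hn hxy)).2]

theorem le_blockRatio (hP : 0 ≤ P) (hσ : 0 < σ) (hn : 0 < n) {ε : ℝ} {x y : Fin n → ℂ}
    (hxy : JointlyTypical P σ h ε x y) :
    2 ^ (n * (Real.logb 2 (1 + snr P σ h) - 3 * ε)) ≤ blockRatio P σ h x y := by
  rw [← Real.le_logb_iff_rpow_le one_lt_two (blockRatio_pos hσ _ _)]
  linarith [(abs_le.1 (abs_log_blockRatio_sub_le hP hσ hn hxy)).1]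

theorem measurableSet_typical {α : Type*} [MeasureSpace α] {f : α → ℝ} (hf : Measurable f)
    (ε : ℝ) : MeasurableSet {w : Fin n → α | Typical ε f w} := by
  unfold Typical Real.logb
  exact measurableSet_lt (by fun_prop) measurable_const

theorem measurable_outputDensity : Measurable (outputDensity P σ h) :=
  measurable_gaussDensity _

theorem measurableSet_jointlyTypical (ε : ℝ) :
    MeasurableSet {q : (Fin n → ℂ) × (Fin n → ℂ) | JointlyTypical P σ h ε q.1 q.2} := by
  refine ((measurableSet_typical (measurable_gaussDensity 1) ε).preimage measurable_fst).inter
    (((measurableSet_typical (measurable_outputDensity (P := P) (σ := σ) (h := h)) ε).preimage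
      measurable_snd).inter ?_)
  exact (measurableSet_typical (measurable_jointDensity P σ h) ε).preimage
    (f := fun (q : (Fin n → ℂ) × (Fin n → ℂ)) i => (q.1 i, q.2 i)) (by fun_prop)

/-- An independent input block is jointly typical with a given output block with probability at
most `2 ^ (-n (log₂ (1 + snr) - 3 ε))`. -/
theorem measure_jointlyTypical_le (hP : 0 ≤ P) (hσ : 0 < σ) (hn : 0 < n) (ε : ℝ)
    (y : Fin n → ℂ) :
    (Measure.pi fun _ : Fin n => complexGaussian 1) {x | JointlyTypical P σ h ε x y}
      ≤ ENNReal.ofReal (2 ^ (-(n * (Real.logb 2 (1 + snr P σ h) - 3 * ε)))) := by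
  set c : ℝ := n * (Real.logb 2 (1 + snr P σ h) - 3 * ε) with hc
  have hm : MeasurableSet {x : Fin n → ℂ | JointlyTypical P σ h ε x y} :=
    (measurableSet_jointlyTypical ε).preimage (f := fun x => (x, y)) (by fun_prop)
  -- Change of measure: on the typical set the indicator is at most `2 ^ (-c)` times the ratio, and
  -- the ratio integrates to 1 over the input.
  rw [← lintegral_indicator_one hm, ← mul_one (ENNReal.ofReal _),
    ← lintegral_blockRatio (P := P) (h := h) hσ y, ← lintegral_const_mul' _ _ ENNReal.ofReal_ne_top]
  refine lintegral_mono fun x => ?_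
  by_cases hx : JointlyTypical P σ h ε x y
  · rw [Set.indicator_of_mem (by exact hx), Pi.one_apply, ← ENNReal.ofReal_mul (by positivity),
      ← ENNReal.ofReal_one]
    refine ENNReal.ofReal_le_ofReal ?_
    have h1 := le_blockRatio hP hσ hn hx
    rw [← hc] at h1
    calc (1 : ℝ) = 2 ^ (-c) * 2 ^ c := by
          rw [← Real.rpow_add two_pos, neg_add_cancel, Real.rpow_zero]
      _ ≤ _ := mul_le_mul_of_nonneg_left h1 (by positivity)
  · rw [Set.indicator_of_notMem (by exact hx)]
    exact zero_le

/-- A block of inputs and the corresponding outputs are jointly typical with high probability,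
uniformly in the channel state. -/
theorem measureReal_not_jointlyTypical_le (hP : 0 ≤ P) (hσ : 0 < σ) (hn : 0 < n) {ε : ℝ}
    (hε : 0 < ε) :
    ((Measure.pi fun _ : Fin n => complexGaussian 1).prod
      (Measure.pi fun _ : Fin n => complexGaussian (σ ^ 2))).real
        {q | ¬ JointlyTypical P σ h ε q.1 (received P h q.1 q.2)}
      ≤ 3 * (1 / (n * (ε * Real.log 2 / 2) ^ 2)) := by
  have := isProbabilityMeasure_noise hσ
  have hl := Real.log_pos one_lt_two
  have hs : 0 < σ ^ 2 := by positivity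
  have hv : 0 < ‖gain P h‖ ^ 2 + σ ^ 2 := by positivity
  have hn' : (0 : ℝ) < n := by exact_mod_cast hn
  -- Half the tolerance, since the joint condition adds the deviations of the input and noise
  -- energies.
  set t := ε * Real.log 2 / 2 with ht
  have ht0 : 0 < t := by positivity
  set μ := (Measure.pi fun _ : Fin n => complexGaussian 1).prod
      (Measure.pi fun _ : Fin n => complexGaussian (σ ^ 2))
  let D : ℝ → Set (Fin n → ℂ) := fun v => {w | t ≤ |(∑ i, ‖w i‖ ^ 2) / (n * v) - 1|}
  have hD : ∀ v, MeasurableSet (D v) := fun v => measurableSet_le measurable_const (by fun_prop)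
  have hbound : ∀ {v : ℝ} (hv : 0 < v) {f : (Fin n → ℂ) × (Fin n → ℂ) → (Fin n → ℂ)}
      (hf : Measurable f), μ.map f = (Measure.pi fun _ : Fin n => complexGaussian v) →
      μ.real (f ⁻¹' D v) ≤ 1 / (n * t ^ 2) := by
    intro v hv f hf hmap
    rw [← map_measureReal_apply hf (hD v), hmap]
    exact measureReal_energy_deviation_le hv hn ht0
  have h1 : μ.real (Prod.fst ⁻¹' D 1) ≤ 1 / (n * t ^ 2) :=
    hbound one_pos measurable_fst Measure.fst_prod
  have h2 : μ.real (Prod.snd ⁻¹' D (σ ^ 2)) ≤ 1 / (n * t ^ 2) :=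
    hbound hs measurable_snd Measure.snd_prod
  have h3 : μ.real ((fun q => received P h q.1 q.2) ⁻¹' D (‖gain P h‖ ^ 2 + σ ^ 2))
      ≤ 1 / (n * t ^ 2) := by
    refine hbound hv (measurable_received P h) ?_
    have := inputOutputLaw_snd (n := n) (P := P) (h := h) hσ
    rw [Measure.snd, inputOutputLaw, Measure.map_map measurable_snd (by fun_prop)] at this
    exact this
  have hsub : {q : (Fin n → ℂ) × (Fin n → ℂ) |
        ¬ JointlyTypical P σ h ε q.1 (received P h q.1 q.2)}
      ⊆ Prod.fst ⁻¹' D 1 ∪ (Prod.snd ⁻¹' D (σ ^ 2) ∪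
        (fun q => received P h q.1 q.2) ⁻¹' D (‖gain P h‖ ^ 2 + σ ^ 2)) := by
    rintro ⟨x, z⟩ hq
    by_contra hc
    simp only [Set.mem_union, Set.mem_preimage, not_or] at hc
    obtain ⟨c1, c2, c3⟩ := hc
    simp only [D, Set.mem_ofPred_eq, not_le] at c1 c2 c3
    refine hq ⟨?_, ?_, ?_⟩
    · rw [typical_gaussDensity_iff one_pos hn]
      linarith
    · rw [outputDensity_eq hP, typical_gaussDensity_iff hv hn]
      linarith
    · rw [typical_jointDensity_iff hσ hn]
      simp only [received_apply, add_sub_cancel_left]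
      rw [mul_one] at c1
      rw [abs_lt] at c1 c2 ⊢
      constructor <;> linarith [c1.1, c1.2, c2.1, c2.2]
  calc _ ≤ _ := measureReal_mono hsub
    _ ≤ _ + (_ + _) := (measureReal_union_le _ _).trans (by gcongr; exact measureReal_union_le _ _)
    _ ≤ _ := by linarith

end Block

end XPHARQ

namespace XPHARQ

/-! ### Mutual information of one round -/

theorem integral_sum_norm_sq {v : ℝ} (hv : 0 < v) (n : ℕ) :
    Integrable (fun w : Fin n → ℂ => ∑ i, ‖w i‖ ^ 2)
        (Measure.pi fun _ : Fin n => complexGaussian v) ∧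
      ∫ w : Fin n → ℂ, ∑ i, ‖w i‖ ^ 2 ∂(Measure.pi fun _ : Fin n => complexGaussian v)
        = n * v := by
  have := isProbabilityMeasure_complexGaussian hv
  have hi : ∀ i : Fin n, Integrable (fun w : Fin n → ℂ => ‖w i‖ ^ 2)
      (Measure.pi fun _ : Fin n => complexGaussian v) := fun i =>
    integrable_comp_eval (μ := fun _ : Fin n => complexGaussian v) (i := i)
      (integrable_norm_sq_complexGaussian hv)
  refine ⟨integrable_finsetSum _ fun i _ => hi i, ?_⟩
  have : ∀ i : Fin n, ∫ w : Fin n → ℂ, ‖w i‖ ^ 2 ∂(Measure.pi fun _ : Fin n => complexGaussian v)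
      = v := fun i => by
    refine (integral_comp_eval (μ := fun _ : Fin n => complexGaussian v) (i := i)
      (f := fun z : ℂ => ‖z‖ ^ 2) (by fun_prop)).trans (integral_norm_sq_complexGaussian hv)
  rw [integral_finsetSum _ fun i _ => hi i, Finset.sum_congr rfl fun i _ => this i]
  simp

variable {n : ℕ} {P σ : ℝ} {h : ℂ}

theorem integral_outputEnergy (hσ : 0 < σ) :
    Integrable (fun q => ∑ i, ‖q.2 i‖ ^ 2) (inputOutputLaw n P σ h) ∧
      ∫ q, ∑ i, ‖q.2 i‖ ^ 2 ∂inputOutputLaw n P σ h = n * (‖gain P h‖ ^ 2 + σ ^ 2) := by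
  have hv : 0 < ‖gain P h‖ ^ 2 + σ ^ 2 := by positivity
  have hm : Measurable fun w : Fin n → ℂ => ∑ i, ‖w i‖ ^ 2 := by fun_prop
  have hI := integral_sum_norm_sq hv n
  have hs := inputOutputLaw_snd (n := n) (P := P) (h := h) hσ
  rw [outputLaw] at hs
  rw [← hs, Measure.snd] at hI
  rw [integrable_map_measure hm.aestronglyMeasurable measurable_snd.aemeasurable,
    integral_map measurable_snd.aemeasurable hm.aestronglyMeasurable] at hI
  exact hI

theorem integral_noiseEnergy (hσ : 0 < σ) :
    Integrable (fun q => ∑ i, ‖q.2 i - gain P h * q.1 i‖ ^ 2) (inputOutputLaw n P σ h) ∧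
      ∫ q, ∑ i, ‖q.2 i - gain P h * q.1 i‖ ^ 2 ∂inputOutputLaw n P σ h = n * σ ^ 2 := by
  have := isProbabilityMeasure_noise hσ
  have hs : 0 < σ ^ 2 := by positivity
  have hm : Measurable fun w : Fin n → ℂ => ∑ i, ‖w i‖ ^ 2 := by fun_prop
  have hm' : Measurable fun q : (Fin n → ℂ) × (Fin n → ℂ) =>
      ∑ i, ‖q.2 i - gain P h * q.1 i‖ ^ 2 := by fun_prop
  have hI := integral_sum_norm_sq hs n
  rw [← Measure.snd_prod (μ := Measure.pi fun _ : Fin n => complexGaussian 1)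
      (ν := Measure.pi fun _ : Fin n => complexGaussian (σ ^ 2)), Measure.snd,
    integrable_map_measure hm.aestronglyMeasurable measurable_snd.aemeasurable,
    integral_map measurable_snd.aemeasurable hm.aestronglyMeasurable] at hI
  rw [inputOutputLaw, integrable_map_measure hm'.aestronglyMeasurable (by fun_prop),
    integral_map (by fun_prop) hm'.aestronglyMeasurable]
  simpa only [Function.comp_def, received_apply, add_sub_cancel_left] using hI

theorem log_blockRatio (hP : 0 ≤ P) (hσ : 0 < σ) (x y : Fin n → ℂ) :
    Real.log (blockRatio P σ h x y) = n * Real.log (1 + snr P σ h)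
      + ((∑ i, ‖y i‖ ^ 2) * (‖gain P h‖ ^ 2 + σ ^ 2)⁻¹
        - (∑ i, ‖y i - gain P h * x i‖ ^ 2) * (σ ^ 2)⁻¹) := by
  have hs : 0 < σ ^ 2 := by positivity
  have : ∀ i, Real.log (likelihoodRatio (gain P h) (σ ^ 2) (x i) (y i))
      = Real.log (1 + snr P σ h) + (‖y i‖ ^ 2 * (‖gain P h‖ ^ 2 + σ ^ 2)⁻¹
        - ‖y i - gain P h * x i‖ ^ 2 * (σ ^ 2)⁻¹) := by
    intro i
    rw [likelihoodRatio, Real.log_mul (by positivity) (Real.exp_ne_zero _), Real.log_exp,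
      one_add_snr hP hσ]
    rfl
  rw [blockRatio, Real.log_prod fun i _ => (likelihoodRatio_pos hs _ _).ne']
  simp_rw [this]
  rw [Finset.sum_add_distrib, Finset.sum_sub_distrib, ← Finset.sum_mul, ← Finset.sum_mul]
  simp

/-- The divergence is the expected log-ratio, and the two normalised energies have the same mean
`n`, so they cancel. Finiteness is part of the claim because `toReal` would turn an infinite
divergence into 0. -/
theorem mutualInfo_eq (hP : 0 < P) (hσ : 0 < σ) :
    mutualInfoNats (inputOutputLaw n P σ h) ≠ ⊤ ∧
      mutualInfo n P σ h = n * Real.logb 2 (1 + snr P σ h) := by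
  have hs : 0 < σ ^ 2 := by positivity
  have hv : 0 < ‖gain P h‖ ^ 2 + σ ^ 2 := by positivity
  have := isProbabilityMeasure_outputLaw (n := n) (P := P) (h := h) hσ
  have := isProbabilityMeasure_inputOutputLaw (n := n) (P := P) (h := h) hσ
  unfold mutualInfo mutualInfoNats
  rw [inputOutputLaw_fst hσ, inputOutputLaw_snd hσ]
  set ν := (Measure.pi fun _ : Fin n => complexGaussian 1).prod (outputLaw n P σ h)
  set J := inputOutputLaw n P σ h with hJ
  have hJd : J = ν.withDensity fun q => ENNReal.ofReal (blockRatio P σ h q.1 q.2) :=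
    inputOutputLaw_eq_withDensity hσ
  have hac : J ≪ ν := hJd ▸ withDensity_absolutelyContinuous _ _
  have hllr : llr J ν =ᵐ[J] fun q => n * Real.log (1 + snr P σ h)
      + ((∑ i, ‖q.2 i‖ ^ 2) * (‖gain P h‖ ^ 2 + σ ^ 2)⁻¹
        - (∑ i, ‖q.2 i - gain P h * q.1 i‖ ^ 2) * (σ ^ 2)⁻¹) := by
    refine hac.ae_le ?_
    have hr := Measure.rnDeriv_withDensity ν
      (measurable_blockRatio (n := n) (P := P) (σ := σ) (h := h)).ennreal_ofReal
    rw [← hJd] at hr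
    filter_upwards [hr] with q hq
    rw [llr, hq, ENNReal.toReal_ofReal (blockRatio_pos hσ _ _).le, log_blockRatio hP.le hσ]
  obtain ⟨i1, e1⟩ := integral_outputEnergy (n := n) (P := P) (h := h) hσ
  obtain ⟨i2, e2⟩ := integral_noiseEnergy (n := n) (P := P) (h := h) hσ
  rw [← hJ] at i1 e1 i2 e2
  have i3 : Integrable (fun q => (∑ i, ‖q.2 i‖ ^ 2) * (‖gain P h‖ ^ 2 + σ ^ 2)⁻¹
      - (∑ i, ‖q.2 i - gain P h * q.1 i‖ ^ 2) * (σ ^ 2)⁻¹) J :=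
    (i1.mul_const (‖gain P h‖ ^ 2 + σ ^ 2)⁻¹).sub (i2.mul_const (σ ^ 2)⁻¹)
  have hint : Integrable (llr J ν) J :=
    ((integrable_const (n * Real.log (1 + snr P σ h))).add i3).congr hllr.symm
  refine ⟨InformationTheory.klDiv_ne_top hac hint, ?_⟩
  rw [InformationTheory.toReal_klDiv_of_measure_eq hac (by simp), integral_congr_ae hllr,
    integral_add (integrable_const _) i3, integral_sub (i1.mul_const _) (i2.mul_const _),
    integral_const, integral_mul_const, integral_mul_const, e1, e2, Real.logb]
  simp only [probReal_univ, smul_eq_mul, one_mul]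
  field_simp
  ring

end XPHARQ

namespace XPHARQ

/-! ### The experiment -/

variable {K : ℕ} {M N : Fin K → ℕ} {P : Fin K → ℝ} {σ : ℝ} {h : Fin K → ℂ} {ε : ℝ}

theorem typicalDecode_eq_some_iff {k : Fin K} {c : Codebook M N} {y : Signal N}
    {p : Prefix M k} :
    typicalDecode P σ h ε c y k = some p ↔
      Candidate P σ h ε c y k p ∧ ∀ r, Candidate P σ h ε c y k r → r = p := by
  unfold typicalDecode
  split_ifs with hm
  · rw [Option.some_inj]
    constructor
    · intro hc
      rw [← hc]
      exact ⟨hm.choose_spec.1, fun p hp => hm.choose_spec.2 p hp⟩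
    · exact fun hc => hc.2 _ hm.choose_spec.1
  · simp only [false_iff]
    exact fun hc => hm ⟨_, hc.1, hc.2⟩

theorem failsAt_iff {k : Fin K} {c : Codebook M N} {m : Messages M} {z : Signal N} :
    FailsAt P σ h ε k (c, m, z) ↔
      ¬ (Candidate P σ h ε c (receivedAll P h c m z) k (m.upTo k) ∧
        ∀ p, Candidate P σ h ε c (receivedAll P h c m z) k p → p = m.upTo k) :=
  not_congr typicalDecode_eq_some_iff

theorem candidate_congr {h' : Fin K → ℂ} {c : Codebook M N} {y y' : Signal N} {k : Fin K}
    (hh : ∀ l ≤ k, h l = h' l) (hy : ∀ l ≤ k, y l = y' l) (p : Prefix M k) :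
    Candidate P σ h ε c y k p ↔ Candidate P σ h' ε c y' k p :=
  forall_congr' fun j => by rw [hh j j.2, hy j j.2]

/-- Decoding after round `k` ignores later channel states; the converse exploits this by setting
them to 0. -/
theorem failsAt_congr {h' : Fin K → ℂ} {k : Fin K} (hh : ∀ l ≤ k, h l = h' l)
    (e : Codebook M N × Messages M × Signal N) :
    FailsAt P σ h ε k e ↔ FailsAt P σ h' ε k e := by
  obtain ⟨c, m, z⟩ := e
  have hy : ∀ l ≤ k, receivedAll P h c m z l = receivedAll P h' c m z l := fun l hl => by
    rw [receivedAll, receivedAll, hh l hl]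
  simp_rw [failsAt_iff, candidate_congr hh hy]

theorem measurableSet_typicalDecode (c : Codebook M N) (k : Fin K) (p : Prefix M k) :
    MeasurableSet {y | typicalDecode P σ h ε c y k = some p} := by
  have hcand : ∀ r : Prefix M k, MeasurableSet {y | Candidate P σ h ε c y k r} := by
    intro r
    unfold Candidate
    rw [Set.ofPred_forall]
    refine MeasurableSet.iInter fun j => ?_
    exact (measurableSet_jointlyTypical ε).preimage
      (f := fun y : Signal N => (c j (r.upTo j), y j)) (by fun_prop)
  have hother : MeasurableSet {y | ∀ r, Candidate P σ h ε c y k r → r = p} := by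
    rw [Set.ofPred_forall]
    refine MeasurableSet.iInter fun r => ?_
    by_cases hr : r = p
    · simp [hr]
    · simp only [hr, imp_false]
      exact (hcand r).compl
  simp_rw [typicalDecode_eq_some_iff]
  exact (hcand p).inter hother

/-- With the entropies evaluated, the conditions are explicit in the channel state too, which makes
joint measurability in the state visible. -/
theorem jointlyTypical_iff {n : ℕ} {P : ℝ} (hP : 0 ≤ P) (hσ : 0 < σ) (hn : 0 < n) {h : ℂ}
    {x y : Fin n → ℂ} :
    JointlyTypical P σ h ε x y ↔
      |(∑ i, ‖x i‖ ^ 2) / (n * 1) - 1| < ε * Real.log 2 ∧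
      |(∑ i, ‖y i‖ ^ 2) / (n * (‖gain P h‖ ^ 2 + σ ^ 2)) - 1| < ε * Real.log 2 ∧
      |(∑ i, ‖x i‖ ^ 2) / n + (∑ i, ‖y i - gain P h * x i‖ ^ 2) / (n * σ ^ 2) - 2|
        < ε * Real.log 2 := by
  unfold JointlyTypical
  rw [typical_gaussDensity_iff one_pos hn, outputDensity_eq hP,
    typical_gaussDensity_iff (by positivity) hn, typical_jointDensity_iff hσ hn]

theorem measurableSet_failsAt (hN : ∀ k, 0 < N k) (hP : ∀ k, 0 ≤ P k) (hσ : 0 < σ) (ε : ℝ)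
    (k : Fin K) :
    MeasurableSet {q : (Fin K → ℂ) × Codebook M N × Messages M × Signal N |
      FailsAt P σ q.1 ε k q.2} := by
  have hcand : ∀ (m : Messages M) (p : Prefix M k),
      MeasurableSet {q : (Fin K → ℂ) × Codebook M N × Messages M × Signal N |
        Candidate P σ q.1 ε q.2.1 (receivedAll P q.1 q.2.1 m q.2.2.2) k p} := by
    intro m p
    unfold Candidate
    rw [Set.ofPred_forall]
    refine MeasurableSet.iInter fun j => ?_
    simp_rw [jointlyTypical_iff (hP j) hσ (hN j), receivedAll, received, gain]
    refine (measurableSet_lt (α := ℝ) ?_ measurable_const).inter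
      ((measurableSet_lt (α := ℝ) ?_ measurable_const).inter
        (measurableSet_lt (α := ℝ) ?_ measurable_const)) <;>
      fun_prop
  -- The transmitted codeword is selected by the random messages; the event is cut into finitely
  -- many pieces on which the messages are constant.
  have : {q : (Fin K → ℂ) × Codebook M N × Messages M × Signal N | FailsAt P σ q.1 ε k q.2}
      = ⋃ m : Messages M, {q | q.2.2.1 = m} ∩
        {q | FailsAt P σ q.1 ε k (q.2.1, m, q.2.2.2)} := by
    ext q
    simp only [Set.mem_iUnion, Set.mem_inter_iff, Set.mem_ofPred_eq]
    constructor
    · exact fun hq => ⟨q.2.2.1, rfl, hq⟩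
    · rintro ⟨m, rfl, hq⟩
      exact hq
  rw [this]
  refine MeasurableSet.iUnion fun m => ?_
  refine (measurableSet_eq_fun (by fun_prop) measurable_const).inter ?_
  simp_rw [failsAt_iff]
  have hother : MeasurableSet {q : (Fin K → ℂ) × Codebook M N × Messages M × Signal N | ∀ p,
      Candidate P σ q.1 ε q.2.1 (receivedAll P q.1 q.2.1 m q.2.2.2) k p → p = m.upTo k} := by
    rw [Set.ofPred_forall]
    refine MeasurableSet.iInter fun p => ?_
    by_cases hp : p = m.upTo k
    · simp [hp]
    · simp only [hp, imp_false]
      exact (hcand m p).compl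
  exact ((hcand m _).inter hother).compl

theorem measurableSet_failsAt_of_state (hN : ∀ k, 0 < N k) (hP : ∀ k, 0 ≤ P k) (hσ : 0 < σ)
    (h : Fin K → ℂ) (ε : ℝ) (k : Fin K) :
    MeasurableSet {e : Codebook M N × Messages M × Signal N | FailsAt P σ h ε k e} :=
  measurable_prodMk_left (x := h) (measurableSet_failsAt hN hP hσ ε k)

instance : IsProbabilityMeasure (gaussianCodebook M N) := by
  unfold gaussianCodebook
  infer_instance

theorem isProbabilityMeasure_noiseLaw (hσ : 0 < σ) : IsProbabilityMeasure (noiseLaw σ N) := by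
  have := isProbabilityMeasure_noise hσ
  unfold noiseLaw
  infer_instance

theorem nonempty_messages (hM : ∀ k, 0 < M k) : Nonempty (Messages M) :=
  ⟨fun k => ⟨0, hM k⟩⟩

theorem isProbabilityMeasure_experiment (hσ : 0 < σ) (hM : ∀ k, 0 < M k) :
    IsProbabilityMeasure (experiment σ M N) := by
  have := isProbabilityMeasure_noiseLaw (N := N) hσ
  have := nonempty_messages hM
  have := isProbabilityMeasure_uniformOn (Set.finite_univ (α := Messages M)) Set.univ_nonempty
  unfold experiment
  infer_instance

theorem uniformOn_prod_apply {α β : Type*} [Fintype α] [MeasurableSpace α]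
    [MeasurableSingletonClass α] [MeasurableSpace β] (ν : Measure β) [SFinite ν]
    {B : Set (α × β)} (hB : MeasurableSet B) :
    ((uniformOn (Set.univ : Set α)).prod ν) B
      = (Fintype.card α : ℝ≥0∞)⁻¹ * ∑ m, ν {z | (m, z) ∈ B} := by
  rw [Measure.prod_apply hB, lintegral_fintype, Finset.mul_sum]
  refine Finset.sum_congr rfl fun m _ => ?_
  rw [uniformOn_univ, Measure.count_singleton, one_div, mul_comm]
  rfl

/-- The experiment is a uniform mixture over the messages sent. -/
theorem experiment_apply (hσ : 0 < σ) {A : Set (Codebook M N × Messages M × Signal N)}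
    (hA : MeasurableSet A) :
    experiment σ M N A = (Fintype.card (Messages M) : ℝ≥0∞)⁻¹ *
      ∑ m, ((gaussianCodebook M N).prod (noiseLaw σ N)) {q | (q.1, m, q.2) ∈ A} := by
  have := isProbabilityMeasure_noiseLaw (N := N) hσ
  have hmeas : ∀ m, MeasurableSet {q : Codebook M N × Signal N | (q.1, m, q.2) ∈ A} := fun m =>
    hA.preimage (f := fun q : Codebook M N × Signal N => (q.1, m, q.2)) (by fun_prop)
  rw [experiment, Measure.prod_apply hA]
  simp_rw [uniformOn_prod_apply (noiseLaw σ N) (measurable_prodMk_left hA)]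
  rw [lintegral_const_mul, lintegral_finsetSum]
  · congr 1
    refine Finset.sum_congr rfl fun m _ => ?_
    rw [Measure.prod_apply (hmeas m)]
    rfl
  · exact fun m _ => measurable_measure_prodMk_left (hmeas m)
  · exact Finset.measurable_sum _ fun m _ => measurable_measure_prodMk_left (hmeas m)

theorem experiment_le_of_forall (hσ : 0 < σ) {A : Set (Codebook M N × Messages M × Signal N)}
    (hA : MeasurableSet A) {B : ℝ≥0∞}
    (h : ∀ m, ((gaussianCodebook M N).prod (noiseLaw σ N)) {q | (q.1, m, q.2) ∈ A} ≤ B) :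
    experiment σ M N A ≤ B := by
  rw [experiment_apply hσ hA]
  calc _ ≤ (Fintype.card (Messages M) : ℝ≥0∞)⁻¹ * ∑ _m : Messages M, B := by
        gcongr with m; exact h m
    _ = ((Fintype.card (Messages M) : ℝ≥0∞)⁻¹ * Fintype.card (Messages M)) * B := by
        simp [mul_assoc]
    _ ≤ 1 * B := by gcongr; exact ENNReal.inv_mul_le_one _
    _ = B := one_mul _

/-! ### Random coding bound -/

theorem measurePreserving_codeword (m : Messages M) (l : Fin K) :
    MeasurePreserving (fun c : Codebook M N => c l (m.upTo l)) (gaussianCodebook M N)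
      (Measure.pi fun _ : Fin (N l) => complexGaussian 1) :=
  (measurePreserving_eval (fun _ : Prefix M l => Measure.pi fun _ : Fin (N l) =>
    complexGaussian 1) (m.upTo l)).comp
    (measurePreserving_eval (fun k => Measure.pi fun _ : Prefix M k =>
      Measure.pi fun _ : Fin (N k) => complexGaussian 1) l)

/-- The probability that the codeword sent in a round of `n` symbols is not typical. -/
noncomputable def atypicalBound (n : ℕ) (ε : ℝ) : ℝ := 3 * (1 / (n * (ε * Real.log 2 / 2) ^ 2))

/-- The probability that another codeword of `n` symbols is typical. -/
noncomputable def confusionBound (n : ℕ) (P σ : ℝ) (h : ℂ) (ε : ℝ) : ℝ :=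
  2 ^ (-(n * (Real.logb 2 (1 + snr P σ h) - 3 * ε)))

theorem measure_not_candidate_le (hN : ∀ k, 0 < N k) (hP : ∀ k, 0 ≤ P k) (hσ : 0 < σ)
    (hε : 0 < ε) (m : Messages M) (k : Fin K) :
    ((gaussianCodebook M N).prod (noiseLaw σ N))
        {q | ¬ Candidate P σ h ε q.1 (receivedAll P h q.1 m q.2) k (m.upTo k)}
      ≤ ∑ l ∈ Finset.Iic k, ENNReal.ofReal (atypicalBound (N l) ε) := by
  have := isProbabilityMeasure_noise hσ
  have := isProbabilityMeasure_noiseLaw (N := N) hσ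
  have hsub : {q : Codebook M N × Signal N |
        ¬ Candidate P σ h ε q.1 (receivedAll P h q.1 m q.2) k (m.upTo k)}
      ⊆ ⋃ l ∈ Finset.Iic k, {q | ¬ JointlyTypical (P l) σ (h l) ε (q.1 l (m.upTo l))
          (received (P l) (h l) (q.1 l (m.upTo l)) (q.2 l))} := by
    intro q hq
    simp only [Set.mem_ofPred_eq, Candidate, not_forall] at hq
    obtain ⟨⟨l, hl⟩, hq⟩ := hq
    simp only [Set.mem_iUnion]
    exact ⟨l, Finset.mem_Iic.2 hl, hq⟩
  refine (measure_mono hsub).trans ((measure_biUnion_finset_le _ _).trans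
    (Finset.sum_le_sum fun l _ => ?_))
  have hmp : MeasurePreserving (fun q : Codebook M N × Signal N => (q.1 l (m.upTo l), q.2 l))
      ((gaussianCodebook M N).prod (noiseLaw σ N))
      ((Measure.pi fun _ : Fin (N l) => complexGaussian 1).prod
        (Measure.pi fun _ : Fin (N l) => complexGaussian (σ ^ 2))) :=
    (measurePreserving_codeword m l).prod
      (measurePreserving_eval (fun k => Measure.pi fun _ : Fin (N k) => complexGaussian (σ ^ 2)) l)
  have hms : MeasurableSet {q : (Fin (N l) → ℂ) × (Fin (N l) → ℂ) |
      ¬ JointlyTypical (P l) σ (h l) ε q.1 (received (P l) (h l) q.1 q.2)} :=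
    ((measurableSet_jointlyTypical ε).preimage
      (f := fun q : (Fin (N l) → ℂ) × (Fin (N l) → ℂ) => (q.1, received (P l) (h l) q.1 q.2))
      (by fun_prop)).compl
  have h1 := hmp.measure_preimage hms.nullMeasurableSet
  refine h1.le.trans ?_
  rw [← ENNReal.ofReal_toReal (measure_ne_top _ _)]
  exact ENNReal.ofReal_le_ofReal (measureReal_not_jointlyTypical_le (hP l) hσ (hN l) hε)

/-- Distinct codewords are independent, so once the noise and the transmitted codeword are fixed,
the other codeword is a fresh Gaussian block facing a fixed output. -/
theorem measure_confusion_le {ι : Type*} [Fintype ι] {n : ℕ} {P : ℝ} (hP : 0 ≤ P) (hσ : 0 < σ)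
    (hn : 0 < n) (h : ℂ) (ε : ℝ) {p r : ι} (hpr : p ≠ r) (z : Fin n → ℂ) :
    (Measure.pi fun _ : ι => Measure.pi fun _ : Fin n => complexGaussian 1)
      {u | JointlyTypical P σ h ε (u p) (received P h (u r) z)}
      ≤ ENNReal.ofReal (confusionBound n P σ h ε) := by
  set μ := Measure.pi fun _ : Fin n => complexGaussian 1
  have hi : iIndepFun (fun (i : ι) (u : ι → Fin n → ℂ) => u i) (Measure.pi fun _ : ι => μ) :=
    iIndepFun_pi (X := fun _ w => w) fun _ => aemeasurable_id
  have hmap := (indepFun_iff_map_prod_eq_prod_map_map (measurable_pi_apply p).aemeasurable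
    (measurable_pi_apply r).aemeasurable).1 (hi.indepFun hpr)
  rw [(measurePreserving_eval (fun _ : ι => μ) p).map_eq,
    (measurePreserving_eval (fun _ : ι => μ) r).map_eq] at hmap
  have hms : MeasurableSet {q : (Fin n → ℂ) × (Fin n → ℂ) |
      JointlyTypical P σ h ε q.1 (received P h q.2 z)} :=
    (measurableSet_jointlyTypical ε).preimage
      (f := fun q : (Fin n → ℂ) × (Fin n → ℂ) => (q.1, received P h q.2 z)) (by
        unfold received; fun_prop)
  have h1 : (Measure.pi fun _ : ι => μ) {u | JointlyTypical P σ h ε (u p) (received P h (u r) z)}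
      = (μ.prod μ) {q | JointlyTypical P σ h ε q.1 (received P h q.2 z)} := by
    rw [← hmap, Measure.map_apply (by fun_prop) hms]
    rfl
  rw [h1, Measure.prod_apply_symm hms]
  calc _ ≤ ∫⁻ _ : Fin n → ℂ, ENNReal.ofReal (confusionBound n P σ h ε) ∂μ :=
        lintegral_mono fun x => measure_jointlyTypical_le hP hσ hn ε (received P h x z)
    _ = _ := by simp

-- For fixed noise the event is a box: it constrains the codebook of each round separately, and
-- these codebooks are independent. A round in which `p` still agrees with the truth reuses the
-- transmitted codeword and contributes only the trivial factor 1.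
open Classical in
theorem measure_candidate_le (hN : ∀ k, 0 < N k) (hP : ∀ k, 0 ≤ P k) (hσ : 0 < σ)
    (m : Messages M) (k : Fin K) (p : Prefix M k) :
    ((gaussianCodebook M N).prod (noiseLaw σ N))
        {q | Candidate P σ h ε q.1 (receivedAll P h q.1 m q.2) k p}
      ≤ ∏ l : Fin K, if hl : l ≤ k then
          (if p.upTo ⟨l, hl⟩ = m.upTo l then 1
            else ENNReal.ofReal (confusionBound (N l) (P l) σ (h l) ε))
        else 1 := by
  have := isProbabilityMeasure_noiseLaw (N := N) hσ
  have hms : MeasurableSet {q : Codebook M N × Signal N |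
      Candidate P σ h ε q.1 (receivedAll P h q.1 m q.2) k p} := by
    unfold Candidate
    rw [Set.ofPred_forall]
    refine MeasurableSet.iInter fun j => ?_
    refine (measurableSet_jointlyTypical ε).preimage
      (f := fun q : Codebook M N × Signal N =>
        (q.1 j (p.upTo j), received (P j) (h j) (q.1 j (m.upTo j)) (q.2 j))) ?_
    unfold received
    fun_prop
  rw [Measure.prod_apply_symm hms]
  refine (lintegral_mono (g := fun _ => _) fun z => ?_).trans_eq (by
    rw [lintegral_const, measure_univ, mul_one])
  have hbox : (fun c => (c, z)) ⁻¹' {q : Codebook M N × Signal N |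
        Candidate P σ h ε q.1 (receivedAll P h q.1 m q.2) k p}
      = Set.univ.pi fun l => {u : Prefix M l → Fin (N l) → ℂ | ∀ hl : l ≤ k,
          JointlyTypical (P l) σ (h l) ε (u (p.upTo ⟨l, hl⟩))
            (received (P l) (h l) (u (m.upTo l)) (z l))} := by
    ext c
    simp only [Set.mem_preimage, Set.mem_ofPred_eq, Set.mem_pi, Set.mem_univ, true_implies]
    exact ⟨fun hc l hl => hc ⟨l, hl⟩, fun hc j => hc j j.2⟩
  rw [hbox, gaussianCodebook, Measure.pi_pi]
  refine Finset.prod_le_prod' fun l _ => ?_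
  split_ifs with hl hpm
  · exact prob_le_one
  · refine (measure_mono ?_).trans (measure_confusion_le (hP l) hσ (hN l) (h l) ε hpm (z l))
    exact fun u hu => hu hl
  · exact prob_le_one

/-- A prefix other than the one sent first differs from it in some round. -/
theorem exists_first_difference {m : Messages M} {k : Fin K} {p : Prefix M k}
    (hp : p ≠ m.upTo k) :
    ∃ j, ∃ hj : j ≤ k, p ⟨j, hj⟩ ≠ m j ∧ ∀ l, ∀ hl : l < j, p ⟨l, hl.le.trans hj⟩ = m l := by
  classical
  have hne : (Finset.univ.filter fun j : Fin K => ∃ hj : j ≤ k, p ⟨j, hj⟩ ≠ m j).Nonempty := by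
    obtain ⟨⟨j, hj⟩, hjp⟩ := Function.ne_iff.1 hp
    exact ⟨j, Finset.mem_filter.2 ⟨Finset.mem_univ _, hj, hjp⟩⟩
  obtain ⟨j, hj, hmin⟩ := Finset.exists_minimal hne
  obtain ⟨-, hjk, hjp⟩ := Finset.mem_filter.1 hj
  refine ⟨j, hjk, hjp, fun l hl => ?_⟩
  by_contra hc
  have := hmin (Finset.mem_filter.2 ⟨Finset.mem_univ l, hl.le.trans hjk, hc⟩) hl.le
  exact absurd hl (not_lt.2 this)

open Classical in
/-- The prefixes that first differ in round `j` from the one sent. -/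
noncomputable def firstDifference (m : Messages M) (k j : Fin K) : Finset (Prefix M k) :=
  Finset.univ.filter fun p => ∃ hj : j ≤ k, p ⟨j, hj⟩ ≠ m j ∧
    ∀ l, ∀ hl : l < j, p ⟨l, hl.le.trans hj⟩ = m l

/-- Messages before `j` are fixed, those from `j` to `k` are free. The value 0 when round `j` has a
single message is essential: rounds with `b j ≤ δ` are of this kind, and the product bound for them
need not decay. -/
theorem card_firstDifference_le (m : Messages M) (k j : Fin K) :
    (firstDifference m k j).card ≤ if M j ≤ 1 then 0 else ∏ l ∈ Finset.Icc j k, M l := by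
  classical
  split_ifs with hM
  · rw [Nat.le_zero, Finset.card_eq_zero, firstDifference, Finset.filter_eq_empty_iff]
    rintro p - ⟨hj, hp, -⟩
    have : Subsingleton (Fin (M j)) := Fin.subsingleton_iff_le_one.2 hM
    exact hp (Subsingleton.elim _ _)
  · have hsub : firstDifference m k j ⊆
        Fintype.piFinset fun l : {l : Fin K // l ≤ k} =>
          if j ≤ l.1 then Finset.univ else {m l.1} := by
      intro p hp
      obtain ⟨-, hj, -, hp⟩ := Finset.mem_filter.1 hp
      rw [Fintype.mem_piFinset]
      rintro ⟨l, hl⟩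
      dsimp only
      split_ifs with hjl
      · exact Finset.mem_univ _
      · exact Finset.mem_singleton.2 (hp l (not_le.1 hjl))
    refine (Finset.card_le_card hsub).trans ?_
    rw [Fintype.card_piFinset]
    apply le_of_eq
    have : ∀ l : {l : Fin K // l ≤ k},
        (if j ≤ l.1 then (Finset.univ : Finset (Fin (M l.1))) else {m l.1}).card
          = if j ≤ l.1 then M l.1 else 1 := by
      intro l
      split_ifs <;> simp
    simp_rw [this]
    rw [← Finset.prod_subtype (Finset.Iic k) (by simp) (fun l => if j ≤ l then M l else 1),
      ← Finset.prod_filter]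
    congr 1
    ext l
    simp [and_comm]

/-- Union bound over the round `j` of first difference. Since the codeword of round `l` depends on
all messages up to `l`, a difference in round `j` persists, and every round from `j` to `k`
contributes a confusion factor. -/
theorem measure_other_candidate_le (hN : ∀ k, 0 < N k) (hP : ∀ k, 0 ≤ P k) (hσ : 0 < σ)
    (m : Messages M) (k : Fin K) :
    ((gaussianCodebook M N).prod (noiseLaw σ N))
        {q | ∃ p, p ≠ m.upTo k ∧ Candidate P σ h ε q.1 (receivedAll P h q.1 m q.2) k p}
      ≤ ∑ j ∈ Finset.Iic k, if M j ≤ 1 then 0 else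
          ∏ l ∈ Finset.Icc j k,
            ((M l : ℝ≥0∞) * ENNReal.ofReal (confusionBound (N l) (P l) σ (h l) ε)) := by
  classical
  have hsub : {q : Codebook M N × Signal N |
        ∃ p, p ≠ m.upTo k ∧ Candidate P σ h ε q.1 (receivedAll P h q.1 m q.2) k p}
      ⊆ ⋃ j ∈ Finset.Iic k, ⋃ p ∈ firstDifference m k j,
        {q | Candidate P σ h ε q.1 (receivedAll P h q.1 m q.2) k p} := by
    rintro q ⟨p, hp, hq⟩
    obtain ⟨j, hj, hjp⟩ := exists_first_difference hp
    simp only [Set.mem_iUnion]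
    exact ⟨j, Finset.mem_Iic.2 hj, p, Finset.mem_filter.2 ⟨Finset.mem_univ _, hj, hjp⟩, hq⟩
  refine (measure_mono hsub).trans ((measure_biUnion_finset_le _ _).trans
    (Finset.sum_le_sum fun j _ => ?_))
  refine (measure_biUnion_finset_le _ _).trans ?_
  have hbound : ∀ p ∈ firstDifference m k j, ((gaussianCodebook M N).prod (noiseLaw σ N))
        {q | Candidate P σ h ε q.1 (receivedAll P h q.1 m q.2) k p}
      ≤ ∏ l ∈ Finset.Icc j k, ENNReal.ofReal (confusionBound (N l) (P l) σ (h l) ε) := by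
    intro p hp
    obtain ⟨-, hj, hjp, hp⟩ := Finset.mem_filter.1 hp
    refine (measure_candidate_le hN hP hσ m k p).trans_eq ?_
    rw [← Finset.prod_filter_mul_prod_filter_not Finset.univ (fun l => l ∈ Finset.Icc j k)]
    rw [Finset.prod_congr (s₂ := Finset.Icc j k) (by ext l; simp) (g := fun l =>
        ENNReal.ofReal (confusionBound (N l) (P l) σ (h l) ε)),
      Finset.prod_eq_one (s := Finset.univ.filter fun l => l ∉ Finset.Icc j k), mul_one]
    · intro l hl
      have hl := (Finset.mem_filter.1 hl).2
      split_ifs with hlk hpm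
      · rfl
      · refine absurd (funext fun i => ?_) hpm
        have hlj : l < j := by
          by_contra hc
          exact hl (Finset.mem_Icc.2 ⟨not_lt.1 hc, hlk⟩)
        exact hp i.1 (i.2.trans_lt hlj)
      · rfl
    · intro l hl
      obtain ⟨hjl, hlk⟩ := Finset.mem_Icc.1 hl
      rw [dif_pos hlk, if_neg]
      intro hpm
      exact hjp (congrFun hpm ⟨j, hjl⟩)
  refine (Finset.sum_le_sum hbound).trans ?_
  rw [Finset.sum_const, nsmul_eq_mul]
  have hcard : ((firstDifference m k j).card : ℝ≥0∞)
      ≤ ((if M j ≤ 1 then 0 else ∏ l ∈ Finset.Icc j k, M l : ℕ) : ℝ≥0∞) := by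
    exact_mod_cast card_firstDifference_le m k j
  refine (mul_le_mul_left hcard _).trans_eq ?_
  split_ifs
  · simp
  · rw [Finset.prod_mul_distrib]
    push_cast
    rfl

/-- The random coding bound for joint-typicality decoding after round `k`. -/
theorem experiment_failsAt_le (hN : ∀ k, 0 < N k) (hP : ∀ k, 0 ≤ P k) (hσ : 0 < σ) (hε : 0 < ε)
    (k : Fin K) :
    experiment σ M N {e | FailsAt P σ h ε k e}
      ≤ ∑ l ∈ Finset.Iic k, ENNReal.ofReal (atypicalBound (N l) ε) +
        ∑ j ∈ Finset.Iic k, if M j ≤ 1 then 0 else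
          ∏ l ∈ Finset.Icc j k,
            ((M l : ℝ≥0∞) * ENNReal.ofReal (confusionBound (N l) (P l) σ (h l) ε)) := by
  refine experiment_le_of_forall hσ (measurableSet_failsAt_of_state hN hP hσ h ε k) fun m => ?_
  have h1 := measure_not_candidate_le (h := h) hN hP hσ hε m k
  have h2 := measure_other_candidate_le (h := h) (ε := ε) hN hP hσ m k
  refine le_trans ?_ (add_le_add h1 h2)
  refine le_trans (measure_mono ?_) (measure_union_le _ _)
  intro q hq
  have hq : FailsAt P σ h ε k (q.1, m, q.2) := hq
  rw [failsAt_iff, not_and_or] at hq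
  rcases hq with hq | hq
  · exact Or.inl hq
  · push Not at hq
    obtain ⟨p, hp, hne⟩ := hq
    exact Or.inr ⟨p, hne, hp⟩

end XPHARQ

namespace XPHARQ

/-! ### Converse for joint-typicality decoding -/

variable {K : ℕ} {M N : Fin K → ℕ} {P : Fin K → ℝ} {σ : ℝ} {h : Fin K → ℂ} {ε : ℝ}

/-- Bound for the number of codewords of `n` symbols that can be decoded correctly. -/
noncomputable def decodableBound (n : ℕ) (P σ : ℝ) (h : ℂ) (ε : ℝ) : ℝ :=
  2 ^ (n * (Real.logb 2 (1 + snr P σ h) + 3 * ε))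

/-- Without channel gain, input and output are independent. Rounds after `k` are switched off in
this way. -/
theorem blockRatio_zero {n : ℕ} (P : ℝ) (hσ : 0 < σ) (x y : Fin n → ℂ) :
    blockRatio P σ 0 x y = 1 := by
  have : σ ^ 2 ≠ 0 := by positivity
  simp [blockRatio, likelihoodRatio, gain, this]

theorem map_receivedAll (hσ : 0 < σ) (c : Codebook M N) (m : Messages M) :
    (noiseLaw σ N).map (receivedAll P h c m)
      = (Measure.pi fun l => outputLaw (N l) (P l) σ (h l)).withDensity fun y =>
        ∏ l, ENNReal.ofReal (blockRatio (P l) σ (h l) (c l (m.upTo l)) (y l)) := by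
  have := isProbabilityMeasure_noise hσ
  have := fun l => isProbabilityMeasure_outputLaw (n := N l) (P := P l) (h := h l) hσ
  have hprob : ∀ l, IsProbabilityMeasure
      ((Measure.pi fun _ : Fin (N l) => complexGaussian (σ ^ 2)).map
        (received (P l) (h l) (c l (m.upTo l)))) := fun l =>
    Measure.isProbabilityMeasure_map (measurable_received_right _ _ _).aemeasurable
  have key := fun l => map_received (P := P l) (h := h l) hσ (c l (m.upTo l))
  have h1 : (noiseLaw σ N).map (receivedAll P h c m)
      = Measure.pi fun l => (Measure.pi fun _ : Fin (N l) => complexGaussian (σ ^ 2)).map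
        (received (P l) (h l) (c l (m.upTo l))) :=
    Measure.pi_map_pi (f := fun l => received (P l) (h l) (c l (m.upTo l)))
      fun l => (measurable_received_right _ _ _).aemeasurable
  have : ∀ l, SigmaFinite ((outputLaw (N l) (P l) σ (h l)).withDensity fun y =>
      ENNReal.ofReal (blockRatio (P l) σ (h l) (c l (m.upTo l)) y)) := fun l => by
    rw [← key l]; infer_instance
  rw [h1]
  simp_rw [key]
  exact pi_withDensity (fun l => outputLaw (N l) (P l) σ (h l))
    (f := fun l y => ENNReal.ofReal (blockRatio (P l) σ (h l) (c l (m.upTo l)) y))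
    fun l => (measurable_blockRatio.comp measurable_prodMk_left).ennreal_ofReal

/-- Change of measure to the output law, which does not involve the messages. A decoded tuple is
typical in each round up to `k`, which bounds the ratio there; later rounds have ratio 1. -/
theorem noiseLaw_decode_le (hN : ∀ k, 0 < N k) (hP : ∀ k, 0 ≤ P k) (hσ : 0 < σ)
    (c : Codebook M N) (m : Messages M) (k : Fin K) (hk : ∀ l, ¬ l ≤ k → h l = 0) :
    noiseLaw σ N {z | typicalDecode P σ h ε c (receivedAll P h c m z) k = some (m.upTo k)}
      ≤ (∏ l ∈ Finset.Iic k, ENNReal.ofReal (decodableBound (N l) (P l) σ (h l) ε)) *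
        (Measure.pi fun l => outputLaw (N l) (P l) σ (h l))
          {y | typicalDecode P σ h ε c y k = some (m.upTo k)} := by
  have hD := measurableSet_typicalDecode (P := P) (σ := σ) (h := h) (ε := ε) c k (m.upTo k)
  have hm : Measurable (receivedAll P h c m) := by
    unfold receivedAll received
    fun_prop
  have h1 : noiseLaw σ N {z | typicalDecode P σ h ε c (receivedAll P h c m z) k = some (m.upTo k)}
      = (noiseLaw σ N).map (receivedAll P h c m)
        {y | typicalDecode P σ h ε c y k = some (m.upTo k)} := by
    rw [Measure.map_apply hm hD]
    rfl
  rw [h1, map_receivedAll hσ, withDensity_apply _ hD]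
  refine (setLIntegral_mono' hD (g := fun _ =>
    ∏ l ∈ Finset.Iic k, ENNReal.ofReal (decodableBound (N l) (P l) σ (h l) ε)) ?_).trans_eq ?_
  · intro y hy
    have hy : typicalDecode P σ h ε c y k = some (m.upTo k) := hy
    have hc := (typicalDecode_eq_some_iff.1 hy).1
    rw [← Finset.prod_filter_mul_prod_filter_not Finset.univ (fun l => l ≤ k)]
    have h2 : ∏ l ∈ Finset.univ.filter (fun l => ¬ l ≤ k),
        ENNReal.ofReal (blockRatio (P l) σ (h l) (c l (m.upTo l)) (y l)) = 1 := by
      refine Finset.prod_eq_one fun l hl => ?_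
      rw [hk l (Finset.mem_filter.1 hl).2, blockRatio_zero _ hσ, ENNReal.ofReal_one]
    rw [h2, mul_one]
    have h3 : Finset.univ.filter (fun l => l ≤ k) = Finset.Iic k := by ext; simp
    rw [h3]
    refine Finset.prod_le_prod' fun l hl => ENNReal.ofReal_le_ofReal ?_
    have hl : l ≤ k := Finset.mem_Iic.1 hl
    exact blockRatio_le (hP l) hσ (hN l) (hc ⟨l, hl⟩)
  · rw [setLIntegral_const]

theorem card_upTo_eq_le (k : Fin K) (o : Option (Prefix M k)) :
    (Finset.univ.filter fun m : Messages M => o = some (m.upTo k)).card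
      ≤ ∏ l ∈ Finset.univ.filter (fun l => ¬ l ≤ k), M l := by
  classical
  cases o with
  | none => simp
  | some p =>
    have hsub : (Finset.univ.filter fun m : Messages M => some p = some (m.upTo k)) ⊆
        Fintype.piFinset fun l => if hl : l ≤ k then {p ⟨l, hl⟩} else Finset.univ := by
      intro m hm
      have hm := Option.some_inj.1 (Finset.mem_filter.1 hm).2
      rw [Fintype.mem_piFinset]
      intro l
      split_ifs with hl
      · rw [Finset.mem_singleton, hm]
        rfl
      · exact Finset.mem_univ _
    refine (Finset.card_le_card hsub).trans ?_
    rw [Fintype.card_piFinset, Finset.prod_filter]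
    refine Finset.prod_le_prod' fun l _ => ?_
    split_ifs with hl <;> simp

/-- One received signal is decoded to at most one prefix, so it is counted once for each choice of
the messages after round `k`. The output law has total mass 1. -/
theorem sum_noiseLaw_decode_le (hN : ∀ k, 0 < N k) (hP : ∀ k, 0 ≤ P k) (hσ : 0 < σ)
    (c : Codebook M N) (k : Fin K) (hk : ∀ l, ¬ l ≤ k → h l = 0) :
    ∑ m : Messages M, noiseLaw σ N
        {z | typicalDecode P σ h ε c (receivedAll P h c m z) k = some (m.upTo k)}
      ≤ (∏ l ∈ Finset.Iic k, ENNReal.ofReal (decodableBound (N l) (P l) σ (h l) ε)) *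
        ∏ l ∈ Finset.univ.filter (fun l => ¬ l ≤ k), (M l : ℝ≥0∞) := by
  classical
  have := fun l => isProbabilityMeasure_outputLaw (n := N l) (P := P l) (h := h l) hσ
  refine (Finset.sum_le_sum fun m _ => noiseLaw_decode_le hN hP hσ c m k hk).trans ?_
  rw [← Finset.mul_sum]
  refine mul_le_mul_right ?_ _
  have hD := fun m : Messages M =>
    measurableSet_typicalDecode (P := P) (σ := σ) (h := h) (ε := ε) c k (m.upTo k)
  simp_rw [← lintegral_indicator_one (hD _)]
  rw [← lintegral_finsetSum _ fun m _ => measurable_one.indicator (hD m)]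
  refine (lintegral_mono (g := fun _ => ∏ l ∈ Finset.univ.filter (fun l => ¬ l ≤ k),
    (M l : ℝ≥0∞)) fun y => ?_).trans_eq (by rw [lintegral_const, measure_univ, mul_one])
  have h1 : ∀ m : Messages M, {y | typicalDecode P σ h ε c y k = some (m.upTo k)}.indicator
      (1 : Signal N → ℝ≥0∞) y
        = if typicalDecode P σ h ε c y k = some (m.upTo k) then 1 else 0 := fun m => by
    rw [Set.indicator_apply]
    rfl
  simp_rw [h1]
  rw [Finset.sum_boole]
  exact_mod_cast card_upTo_eq_le k (typicalDecode P σ h ε c y k)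

/-- Above capacity, joint-typicality decoding rarely succeeds. -/
theorem experiment_not_failsAt_le (hM : ∀ k, 0 < M k) (hN : ∀ k, 0 < N k) (hP : ∀ k, 0 ≤ P k)
    (hσ : 0 < σ) (k : Fin K) :
    experiment σ M N {e | ¬ FailsAt P σ h ε k e}
      ≤ ∏ l ∈ Finset.Iic k,
        (ENNReal.ofReal (decodableBound (N l) (P l) σ (h l) ε) * (M l : ℝ≥0∞)⁻¹) := by
  classical
  have := isProbabilityMeasure_noiseLaw (N := N) hσ
  set h' : Fin K → ℂ := fun l => if l ≤ k then h l else 0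
  have hh : ∀ l ≤ k, h l = h' l := fun l hl => (if_pos hl).symm
  have hh0 : ∀ l, ¬ l ≤ k → h' l = 0 := fun l hl => if_neg hl
  simp_rw [failsAt_congr hh]
  have hA : MeasurableSet {e : Codebook M N × Messages M × Signal N | ¬ FailsAt P σ h' ε k e} :=
    (measurableSet_failsAt_of_state hN hP hσ h' ε k).compl
  rw [experiment_apply hσ hA]
  have hAm : ∀ m, MeasurableSet {q : Codebook M N × Signal N |
      (q.1, m, q.2) ∈ {e : Codebook M N × Messages M × Signal N | ¬ FailsAt P σ h' ε k e}} :=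
    fun m => hA.preimage (f := fun q : Codebook M N × Signal N => (q.1, m, q.2)) (by fun_prop)
  simp_rw [Measure.prod_apply (hAm _)]
  rw [← lintegral_finsetSum _ fun m _ => measurable_measure_prodMk_left (hAm m)]
  set B := (∏ l ∈ Finset.Iic k, ENNReal.ofReal (decodableBound (N l) (P l) σ (h' l) ε)) with hB
  have hbound : ∀ c : Codebook M N, ∑ m : Messages M, noiseLaw σ N (Prod.mk c ⁻¹'
      {q : Codebook M N × Signal N |
        (q.1, m, q.2) ∈ {e : Codebook M N × Messages M × Signal N | ¬ FailsAt P σ h' ε k e}})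
      ≤ B * ∏ l ∈ Finset.univ.filter (fun l => ¬ l ≤ k), (M l : ℝ≥0∞) := by
    intro c
    refine le_trans (le_of_eq (Finset.sum_congr rfl fun m _ => ?_))
      (sum_noiseLaw_decode_le (ε := ε) hN hP hσ c k hh0)
    congr 1
    ext z
    exact not_not
  refine (mul_le_mul_right (lintegral_mono hbound) _).trans_eq ?_
  rw [lintegral_const, measure_univ, mul_one]
  -- The messages of later rounds cancel against the number of times each received signal was
  -- counted.
  have hcard : (Fintype.card (Messages M) : ℝ≥0∞)
      = (∏ l ∈ Finset.Iic k, (M l : ℝ≥0∞)) *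
        ∏ l ∈ Finset.univ.filter (fun l => ¬ l ≤ k), (M l : ℝ≥0∞) := by
    have h3 : Finset.univ.filter (fun l => l ≤ k) = Finset.Iic k := by ext; simp
    rw [← h3, Finset.prod_filter_mul_prod_filter_not]
    simp
  have hR0 : ∏ l ∈ Finset.univ.filter (fun l => ¬ l ≤ k), (M l : ℝ≥0∞) ≠ 0 :=
    Finset.prod_ne_zero_iff.2 fun l _ => by exact_mod_cast (hM l).ne'
  have hRt : ∏ l ∈ Finset.univ.filter (fun l => ¬ l ≤ k), (M l : ℝ≥0∞) ≠ ⊤ :=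
    ENNReal.prod_ne_top fun l _ => ENNReal.natCast_ne_top _
  have hB' : ∏ l ∈ Finset.Iic k, ENNReal.ofReal (decodableBound (N l) (P l) σ (h l) ε) = B :=
    Finset.prod_congr rfl fun l hl => by rw [hh l (Finset.mem_Iic.1 hl)]
  rw [Finset.prod_mul_distrib, hB', hcard, ENNReal.mul_inv (Or.inr hRt) (Or.inr hR0),
    ENNReal.prod_inv_distrib]
  · rw [mul_comm B, mul_comm B, mul_assoc,
      ← mul_assoc (∏ l ∈ Finset.univ.filter (fun l => ¬ l ≤ k), (M l : ℝ≥0∞))⁻¹,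
      ENNReal.inv_mul_cancel hR0 hRt, one_mul]
  · exact fun i _ j _ _ => Or.inr (ENNReal.natCast_ne_top _)

end XPHARQ

namespace XPHARQ

/-! ### Exponents -/

variable {K : ℕ}

theorem one_le_numMessages (b : Fin K → ℝ) (δ : ℝ) (n : ℕ) (k : Fin K) :
    0 < numMessages b δ n k :=
  Nat.ceil_pos.2 (by positivity)

theorem le_numMessages (b : Fin K → ℝ) (δ : ℝ) (n : ℕ) (k : Fin K) :
    (2 : ℝ) ^ ((n : ℝ) * (b k - δ)) ≤ numMessages b δ n k :=
  Nat.le_ceil _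

/-- The ceiling is at most `x + 1 ≤ 2 max x 1`; the maximum in the exponent covers rates below the
back-off. -/
theorem numMessages_le (b : Fin K → ℝ) (δ : ℝ) (n : ℕ) (k : Fin K) :
    (numMessages b δ n k : ℝ) ≤ 2 * 2 ^ ((n : ℝ) * max (b k - δ) 0) := by
  have h1 : (numMessages b δ n k : ℝ) ≤ 2 ^ ((n : ℝ) * (b k - δ)) + 1 :=
    (Nat.ceil_lt_add_one (by positivity)).le
  have h2 : (2 : ℝ) ^ ((n : ℝ) * (b k - δ)) ≤ 2 ^ ((n : ℝ) * max (b k - δ) 0) :=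
    Real.rpow_le_rpow_of_exponent_le one_le_two
      (mul_le_mul_of_nonneg_left (le_max_left _ _) n.cast_nonneg)
  have h3 : (1 : ℝ) ≤ 2 ^ ((n : ℝ) * max (b k - δ) 0) :=
    Real.one_le_rpow one_le_two (mul_nonneg n.cast_nonneg (le_max_right _ _))
  linarith

theorem numMessages_eq_one {b : Fin K → ℝ} {δ : ℝ} {k : Fin K} (h : b k ≤ δ) (n : ℕ) :
    numMessages b δ n k = 1 := by
  refine le_antisymm (Nat.ceil_le.2 ?_) (one_le_numMessages b δ n k)
  rw [Nat.cast_one]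
  exact Real.rpow_le_one_of_one_le_of_nonpos one_le_two
    (mul_nonpos_of_nonneg_of_nonpos n.cast_nonneg (by linarith))

theorem prod_two_rpow {ι : Type*} (s : Finset ι) (f : ι → ℝ) :
    ∏ i ∈ s, (2 : ℝ) ^ f i = 2 ^ ∑ i ∈ s, f i :=
  (Real.rpow_sum_of_pos two_pos f s).symm

/-- An upper bound for the probability of failure below capacity. -/
noncomputable def directError (K : ℕ) (ε δ : ℝ) (n : ℕ) : ℝ :=
  K * atypicalBound n ε + K * (2 ^ K * 2 ^ (-((n : ℝ) * (δ / 2))))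

theorem tendsto_two_rpow_neg {δ : ℝ} (hδ : 0 < δ) :
    Tendsto (fun n : ℕ => (2 : ℝ) ^ (-((n : ℝ) * (δ / 2)))) atTop (𝓝 0) := by
  have h1 : Tendsto (fun n : ℕ => ((2 : ℝ) ^ (-(δ / 2))) ^ n) atTop (𝓝 0) :=
    tendsto_pow_atTop_nhds_zero_of_lt_one (by positivity)
      (Real.rpow_lt_one_of_one_lt_of_neg one_lt_two (by linarith))
  refine h1.congr fun n => ?_
  rw [← Real.rpow_mul_natCast two_pos.le]
  congr 1
  ring

theorem tendsto_atypicalBound {ε : ℝ} :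
    Tendsto (fun n : ℕ => atypicalBound n ε) atTop (𝓝 0) := by
  have h1 : Tendsto (fun n : ℕ => 3 * (1 / (n : ℝ) * (1 / (ε * Real.log 2 / 2) ^ 2))) atTop
      (𝓝 (3 * (0 * (1 / (ε * Real.log 2 / 2) ^ 2)))) :=
    (tendsto_one_div_atTop_nhds_zero_nat.mul_const _).const_mul _
  rw [zero_mul, mul_zero] at h1
  refine h1.congr fun n => ?_
  rw [atypicalBound, one_div_mul_one_div]

theorem tendsto_directError (K : ℕ) {ε δ : ℝ} (hδ : 0 < δ) :
    Tendsto (directError K ε δ) atTop (𝓝 0) := by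
  have := (tendsto_atypicalBound (ε := ε)).const_mul (K : ℝ) |>.add
    (((tendsto_two_rpow_neg hδ).const_mul (2 ^ K : ℝ)).const_mul (K : ℝ))
  rw [mul_zero, mul_zero, mul_zero, add_zero] at this
  exact this

theorem atypicalBound_nonneg (n : ℕ) (ε : ℝ) : 0 ≤ atypicalBound n ε := by
  unfold atypicalBound
  positivity

theorem confusionBound_nonneg (n : ℕ) (P σ : ℝ) (h : ℂ) (ε : ℝ) :
    0 ≤ confusionBound n P σ h ε :=
  Real.rpow_nonneg two_pos.le _

theorem decodableBound_nonneg (n : ℕ) (P σ : ℝ) (h : ℂ) (ε : ℝ) :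
    0 ≤ decodableBound n P σ h ε :=
  Real.rpow_nonneg two_pos.le _

theorem directError_nonneg (K : ℕ) (ε δ : ℝ) (n : ℕ) : 0 ≤ directError K ε δ n := by
  have := atypicalBound_nonneg n ε
  unfold directError
  positivity

theorem atypicalBound_mono {n n' : ℕ} (hn : 0 < n) (h : n ≤ n') {ε : ℝ} (hε : 0 < ε) :
    atypicalBound n' ε ≤ atypicalBound n ε := by
  have := Real.log_pos one_lt_two
  have : (0 : ℝ) < n := by exact_mod_cast hn
  unfold atypicalBound
  gcongr

variable {N : Fin K → ℕ} {P : Fin K → ℝ} {σ : ℝ} {h : Fin K → ℂ} {b : Fin K → ℝ} {ε δ : ℝ}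

theorem blockLength_pos (hN : ∀ k, 0 < N k) {n : ℕ} (hn : 0 < n) (k : Fin K) :
    0 < blockLength N n k :=
  Nat.mul_pos hn (hN k)

/-- Accounting of exponents. Round `j` has at least two messages, hence `b j > δ` and it saves the
whole back-off `δ`; the other rounds are charged `b l`. The slack `ε` in the capacity condition,
which later pays for the reduced power, and the `3 ε` of typicality cost at most `δ / 2` together.
-/
theorem prod_confusionBound_le (hb : ∀ k, 0 ≤ b k) (hε : 0 < ε)
    (hεδ : 8 * ε * ∑ l, (N l : ℝ) ≤ δ) {j k : Fin K} (hjk : j ≤ k)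
    (hcap : ∑ l ∈ Finset.Icc j k, b l
      ≤ ∑ l ∈ Finset.Icc j k, (N l : ℝ) * (Real.logb 2 (1 + snr (P l) σ (h l)) + ε))
    {n : ℕ} (hM : 1 < numMessages b δ n j) :
    ∏ l ∈ Finset.Icc j k, ((numMessages b δ n l : ℝ) *
        confusionBound (blockLength N n l) (P l) σ (h l) ε)
      ≤ 2 ^ K * 2 ^ (-((n : ℝ) * (δ / 2))) := by
  have hδ : 0 ≤ δ := le_trans (by positivity) hεδ
  have hbj : δ < b j := by
    by_contra hc
    rw [numMessages_eq_one (not_lt.1 hc)] at hM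
    exact lt_irrefl _ hM
  set E : Fin K → ℝ := fun l => n * (max (b l - δ) 0
    - N l * (Real.logb 2 (1 + snr (P l) σ (h l)) - 3 * ε)) with hE
  have h1 : ∀ l, (numMessages b δ n l : ℝ) * confusionBound (blockLength N n l) (P l) σ (h l) ε
      ≤ 2 * 2 ^ E l := by
    intro l
    have : (2 : ℝ) * 2 ^ E l = 2 * 2 ^ ((n : ℝ) * max (b l - δ) 0) *
        confusionBound (blockLength N n l) (P l) σ (h l) ε := by
      rw [confusionBound, mul_assoc, ← Real.rpow_add two_pos]
      congr 2
      simp only [hE, blockLength]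
      push_cast
      ring
    rw [this]
    exact mul_le_mul_of_nonneg_right (numMessages_le b δ n l)
      (confusionBound_nonneg _ _ _ _ _)
  have hjm : j ∈ Finset.Icc j k := Finset.mem_Icc.2 ⟨le_rfl, hjk⟩
  have h2 : ∑ l ∈ Finset.Icc j k, max (b l - δ) 0 ≤ ∑ l ∈ Finset.Icc j k, b l - δ := by
    rw [← Finset.add_sum_erase _ _ hjm, ← Finset.add_sum_erase _ b hjm,
      max_eq_left (by linarith : (0 : ℝ) ≤ b j - δ)]
    have : ∑ l ∈ (Finset.Icc j k).erase j, max (b l - δ) 0 ≤ ∑ l ∈ (Finset.Icc j k).erase j, b l :=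
      Finset.sum_le_sum fun l _ => max_le (by linarith) (hb l)
    linarith
  have h3 : ∑ l ∈ Finset.Icc j k, (N l : ℝ) ≤ ∑ l, (N l : ℝ) :=
    Finset.sum_le_univ_sum_of_nonneg fun l => (N l).cast_nonneg
  have h4 : ∑ l ∈ Finset.Icc j k, E l ≤ -((n : ℝ) * (δ / 2)) := by
    rw [hE, ← Finset.mul_sum, ← mul_neg]
    refine mul_le_mul_of_nonneg_left ?_ n.cast_nonneg
    have e1 : ∑ l ∈ Finset.Icc j k,
          (N l : ℝ) * (Real.logb 2 (1 + snr (P l) σ (h l)) - 3 * ε)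
        = ∑ l ∈ Finset.Icc j k, (N l : ℝ) * (Real.logb 2 (1 + snr (P l) σ (h l)) + ε)
          - 4 * ε * ∑ l ∈ Finset.Icc j k, (N l : ℝ) := by
      rw [Finset.mul_sum, ← Finset.sum_sub_distrib]
      exact Finset.sum_congr rfl fun l _ => by ring
    rw [Finset.sum_sub_distrib, e1]
    have := mul_le_mul_of_nonneg_left h3 (by positivity : 0 ≤ 4 * ε)
    linarith
  calc _ ≤ ∏ l ∈ Finset.Icc j k, ((2 : ℝ) * 2 ^ E l) :=
        Finset.prod_le_prod (fun l _ => mul_nonneg (Nat.cast_nonneg _)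
          (confusionBound_nonneg _ _ _ _ _)) fun l _ => h1 l
    _ = 2 ^ (Finset.Icc j k).card * 2 ^ ∑ l ∈ Finset.Icc j k, E l := by
        rw [Finset.prod_mul_distrib, Finset.prod_const, prod_two_rpow]
    _ ≤ _ := by
        refine mul_le_mul (pow_le_pow_right₀ one_le_two ?_)
          (Real.rpow_le_rpow_of_exponent_le one_le_two h4) (by positivity) (by positivity)
        exact (Finset.card_le_univ _).trans (Fintype.card_fin K).le

/-- Below capacity decoding after round `k` fails with a probability that tends to `0` uniformly
in the channel state. -/
theorem experiment_failsAt_le_directError (hN : ∀ k, 0 < N k) (hP : ∀ k, 0 ≤ P k) (hσ : 0 < σ)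
    (hb : ∀ k, 0 ≤ b k) (hε : 0 < ε) (hεδ : 8 * ε * ∑ l, (N l : ℝ) ≤ δ) {k : Fin K}
    (hcap : ∀ j ≤ k, ∑ l ∈ Finset.Icc j k, b l
      ≤ ∑ l ∈ Finset.Icc j k, (N l : ℝ) * (Real.logb 2 (1 + snr (P l) σ (h l)) + ε))
    {n : ℕ} (hn : 0 < n) :
    experiment σ (numMessages b δ n) (blockLength N n) {e | FailsAt P σ h ε k e}
      ≤ ENNReal.ofReal (directError K ε δ n) := by
  have hcard : (Finset.Iic k).card ≤ K := (Finset.card_le_univ _).trans (Fintype.card_fin K).le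
  refine (experiment_failsAt_le (blockLength_pos hN hn) hP hσ hε k).trans ?_
  have ha := atypicalBound_nonneg n ε
  rw [directError, ENNReal.ofReal_add (by positivity) (by positivity)]
  refine add_le_add ?_ ?_
  · refine (Finset.sum_le_card_nsmul _ _ (ENNReal.ofReal (atypicalBound n ε)) fun l _ =>
      ENNReal.ofReal_le_ofReal
        (atypicalBound_mono hn (Nat.le_mul_of_pos_right n (hN l)) hε)).trans ?_
    rw [nsmul_eq_mul, ENNReal.ofReal_mul (by positivity), ENNReal.ofReal_natCast]
    gcongr
  · refine (Finset.sum_le_card_nsmul _ _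
      (ENNReal.ofReal (2 ^ K * 2 ^ (-((n : ℝ) * (δ / 2))))) fun j hj => ?_).trans ?_
    · split_ifs with hM
      · exact zero_le
      · have hj := Finset.mem_Iic.1 hj
        have h1 : ∀ l, (numMessages b δ n l : ℝ≥0∞) *
              ENNReal.ofReal (confusionBound (blockLength N n l) (P l) σ (h l) ε)
            = ENNReal.ofReal ((numMessages b δ n l : ℝ) *
              confusionBound (blockLength N n l) (P l) σ (h l) ε) := fun l => by
          rw [ENNReal.ofReal_mul (by positivity), ENNReal.ofReal_natCast]
        simp_rw [h1]
        rw [← ENNReal.ofReal_prod_of_nonneg fun l _ => mul_nonneg (Nat.cast_nonneg _)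
          (confusionBound_nonneg _ _ _ _ _)]
        exact ENNReal.ofReal_le_ofReal
          (prod_confusionBound_le hb hε hεδ hj (hcap j hj) (not_le.1 hM))
    · rw [nsmul_eq_mul, ENNReal.ofReal_mul (p := (K : ℝ)) (by positivity),
        ENNReal.ofReal_natCast]
      gcongr

/-- Above capacity decoding after round `k` succeeds with a probability that tends to `0`
uniformly in the channel state. -/
theorem experiment_not_failsAt_le_two_rpow (hN : ∀ k, 0 < N k) (hP : ∀ k, 0 ≤ P k) (hσ : 0 < σ)
    (hε : 0 < ε) (hεδ : 8 * ε * ∑ l, (N l : ℝ) ≤ δ) {k : Fin K}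
    (hcap : ∑ l ∈ Finset.Iic k, (N l : ℝ) * Real.logb 2 (1 + snr (P l) σ (h l))
      ≤ ∑ l ∈ Finset.Iic k, b l - (K + 1) * δ)
    {n : ℕ} (hn : 0 < n) :
    experiment σ (numMessages b δ n) (blockLength N n) {e | ¬ FailsAt P σ h ε k e}
      ≤ ENNReal.ofReal (2 ^ (-((n : ℝ) * (δ / 2)))) := by
  have hδ : 0 ≤ δ := le_trans (by positivity) hεδ
  refine (experiment_not_failsAt_le (one_le_numMessages b δ n) (blockLength_pos hN hn) hP hσ
    k).trans ?_
  set E : Fin K → ℝ := fun l => n * (N l * Real.logb 2 (1 + snr (P l) σ (h l)) + 3 * ε * N l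
    - b l + δ) with hE
  have h1 : ∀ l, ENNReal.ofReal (decodableBound (blockLength N n l) (P l) σ (h l) ε) *
      (numMessages b δ n l : ℝ≥0∞)⁻¹ ≤ ENNReal.ofReal (2 ^ E l) := by
    intro l
    have hpos : (0 : ℝ) < numMessages b δ n l := by exact_mod_cast one_le_numMessages b δ n l
    rw [← ENNReal.ofReal_natCast, ← ENNReal.ofReal_inv_of_pos hpos,
      ← ENNReal.ofReal_mul (decodableBound_nonneg _ _ _ _ _)]
    refine ENNReal.ofReal_le_ofReal ?_
    rw [← div_eq_mul_inv, div_le_iff₀ hpos]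
    refine le_trans (le_of_eq ?_) (mul_le_mul_of_nonneg_left (le_numMessages b δ n l)
      (by positivity))
    rw [decodableBound, ← Real.rpow_add two_pos]
    congr 1
    simp only [hE, blockLength]
    push_cast
    ring
  refine (Finset.prod_le_prod' fun l _ => h1 l).trans ?_
  rw [← ENNReal.ofReal_prod_of_nonneg fun l _ => by positivity, prod_two_rpow]
  refine ENNReal.ofReal_le_ofReal (Real.rpow_le_rpow_of_exponent_le one_le_two ?_)
  -- The margin `(K + 1) δ` pays the back-off of at most `K` rounds; the remaining `δ` covers the
  -- typicality loss, at most `3 δ / 8`, and still leaves `δ / 2`.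
  rw [hE, ← Finset.mul_sum, ← mul_neg]
  refine mul_le_mul_of_nonneg_left ?_ n.cast_nonneg
  rw [Finset.sum_add_distrib, Finset.sum_sub_distrib, Finset.sum_add_distrib, ← Finset.mul_sum,
    Finset.sum_const, nsmul_eq_mul]
  have hcard : ((Finset.Iic k).card : ℝ) ≤ K := by
    exact_mod_cast (Finset.card_le_univ _).trans (Fintype.card_fin K).le
  have h3 : ∑ l ∈ Finset.Iic k, (N l : ℝ) ≤ ∑ l, (N l : ℝ) :=
    Finset.sum_le_univ_sum_of_nonneg fun l => (N l).cast_nonneg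
  have h4 := mul_le_mul_of_nonneg_left h3 (by positivity : 0 ≤ 3 * ε)
  have h5 := mul_le_mul_of_nonneg_right hcard hδ
  have h6 : 0 ≤ ε * ∑ l, (N l : ℝ) := by positivity
  linarith

end XPHARQ

namespace XPHARQ

/-! ### From average to maximal error -/

/-- Some codebook is as good as the average. -/
theorem exists_codebook_sum_le {K : ℕ} {M N : Fin K → ℕ} {P : Fin K → ℝ} {σ : ℝ}
    (h : Fin K → ℂ) (ε : ℝ) (hM : ∀ k, 0 < M k) (hN : ∀ k, 0 < N k) (hP : ∀ k, 0 ≤ P k)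
    (hσ : 0 < σ) (k : Fin K) :
    ∃ c : Codebook M N, ∑ m, noiseLaw σ N {z | FailsAt P σ h ε k (c, m, z)}
      ≤ Fintype.card (Messages M) * experiment σ M N {e | FailsAt P σ h ε k e} := by
  have := isProbabilityMeasure_noiseLaw (N := N) hσ
  have := nonempty_messages hM
  have hA := measurableSet_failsAt_of_state (M := M) hN hP hσ h ε k
  have hAm : ∀ m, MeasurableSet {q : Codebook M N × Signal N | FailsAt P σ h ε k (q.1, m, q.2)} :=
    fun m => hA.preimage (f := fun q : Codebook M N × Signal N => (q.1, m, q.2)) (by fun_prop)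
  have hmeas : ∀ m, Measurable fun c : Codebook M N =>
      noiseLaw σ N {z | FailsAt P σ h ε k (c, m, z)} := fun m =>
    measurable_measure_prodMk_left (hAm m)
  obtain ⟨c, hc⟩ := exists_le_lintegral (μ := gaussianCodebook M N)
    (Finset.measurable_sum Finset.univ fun m _ => hmeas m).aemeasurable
  refine ⟨c, ?_⟩
  rw [experiment_apply hσ hA, ← mul_assoc, ENNReal.mul_inv_cancel
    (by exact_mod_cast Fintype.card_ne_zero) (ENNReal.natCast_ne_top _), one_mul]
  rw [lintegral_finsetSum _ fun m _ => hmeas m] at hc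
  refine hc.trans_eq (Finset.sum_congr rfl fun m _ => ?_)
  exact (Measure.prod_apply (hAm m)).symm

/-- Expurgation: a sizeable part of the rows of a nonnegative matrix have a sizeable part of
entries that are not much larger than the average. -/
theorem exists_expurgation {A B a b : ℕ} (hA : 0 < A) (hB : 0 < B) (ha : 4 * a ≤ 3 * A + 4)
    (hb : 4 * b ≤ 3 * B + 4) {err : Fin A → Fin B → ℝ} (herr : ∀ i j, 0 ≤ err i j) {e : ℝ}
    (hsum : ∑ i, ∑ j, err i j ≤ A * B * e) :
    ∃ (φ : Fin a → Fin A) (ψ : Fin a → Fin b → Fin B), Function.Injective φ ∧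
      (∀ i, Function.Injective (ψ i)) ∧ ∀ i j, err (φ i) (ψ i j) ≤ 16 * e := by
  classical
  let good : Fin A → Finset (Fin B) := fun i => Finset.univ.filter fun j => err i j ≤ 16 * e
  let rows : Finset (Fin A) := Finset.univ.filter fun i => b ≤ (good i).card
  have he : 0 ≤ e := by
    have h1 : 0 ≤ (A : ℝ) * B * e :=
      (Finset.sum_nonneg fun i _ => Finset.sum_nonneg fun j _ => herr i j).trans hsum
    have : (0 : ℝ) < A * B := by positivity
    exact nonneg_of_mul_nonneg_right h1 this
  by_cases hr : a ≤ rows.card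
  · have hrow : ∀ i : Fin a, b ≤ (good (rows.orderEmbOfCardLe hr i)).card := fun i =>
      (Finset.mem_filter.1 (Finset.orderEmbOfCardLe_mem rows hr i)).2
    refine ⟨fun i => rows.orderEmbOfCardLe hr i, fun i j =>
      (good (rows.orderEmbOfCardLe hr i)).orderEmbOfCardLe (hrow i) j,
      (rows.orderEmbOfCardLe hr).injective, fun i =>
      ((good (rows.orderEmbOfCardLe hr i)).orderEmbOfCardLe (hrow i)).injective, fun i j => ?_⟩
    exact (Finset.mem_filter.1 (Finset.orderEmbOfCardLe_mem _ (hrow i) j)).2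
  -- At most `a - 1` rows are good, so at least `A / 4` are bad, and likewise each of these has at
  -- least `B / 4` entries above `16 e`. Their sum would exceed `A B e`; the `+ 4` in the hypotheses
  -- accounts for `a - 1` and `b - 1`.
  · exfalso
    have hbad : A ≤ 4 * rowsᶜ.card := by
      have := Finset.card_add_card_compl rows
      rw [Fintype.card_fin] at this
      omega
    have hrow : ∀ i ∈ rowsᶜ, (B : ℝ) / 4 * (16 * e) < ∑ j, err i j := by
      intro i hi
      have hi : ¬ b ≤ (good i).card := fun hc =>
        Finset.mem_compl.1 hi (Finset.mem_filter.2 ⟨Finset.mem_univ _, hc⟩)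
      have hc : B ≤ 4 * (good i)ᶜ.card := by
        have := Finset.card_add_card_compl (good i)
        rw [Fintype.card_fin] at this
        omega
      have hne : (good i)ᶜ.Nonempty := Finset.card_pos.1 (by omega)
      calc (B : ℝ) / 4 * (16 * e) ≤ (good i)ᶜ.card * (16 * e) := by
            refine mul_le_mul_of_nonneg_right ?_ (by positivity)
            rw [div_le_iff₀ (by norm_num)]
            have : (B : ℝ) ≤ 4 * (good i)ᶜ.card := by exact_mod_cast hc
            linarith
        _ = ∑ _j ∈ (good i)ᶜ, 16 * e := by rw [Finset.sum_const, nsmul_eq_mul]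
        _ < ∑ j ∈ (good i)ᶜ, err i j := by
            refine Finset.sum_lt_sum_of_nonempty hne fun j hj => ?_
            by_contra hc
            exact Finset.mem_compl.1 hj (Finset.mem_filter.2 ⟨Finset.mem_univ _, not_lt.1 hc⟩)
        _ ≤ ∑ j, err i j := Finset.sum_le_univ_sum_of_nonneg (herr i)
    have hne : rowsᶜ.Nonempty := Finset.card_pos.1 (by omega)
    refine lt_irrefl ((A : ℝ) * B * e) ?_
    calc (A : ℝ) * B * e = A / 4 * (B / 4 * (16 * e)) := by ring
      _ ≤ rowsᶜ.card * (B / 4 * (16 * e)) := by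
          refine mul_le_mul_of_nonneg_right ?_ (by positivity)
          rw [div_le_iff₀ (by norm_num)]
          have : (A : ℝ) ≤ 4 * rowsᶜ.card := by exact_mod_cast hbad
          linarith
      _ = ∑ _i ∈ rowsᶜ, B / 4 * (16 * e) := by rw [Finset.sum_const, nsmul_eq_mul]
      _ < ∑ i ∈ rowsᶜ, ∑ j, err i j := Finset.sum_lt_sum_of_nonempty hne hrow
      _ ≤ ∑ i, ∑ j, err i j :=
          Finset.sum_le_univ_sum_of_nonneg fun i => Finset.sum_nonneg fun j _ => herr i j
      _ ≤ _ := hsum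

/-! ### HARQ codes from re-indexed and rescaled codebooks -/

section Subcode

variable {K : ℕ} {M M' N : Fin K → ℕ}

/-- A map of messages under which `(m₁, …, m_k)` determines the first `k` new messages. -/
def Causal (Φ : Messages M → Messages M') : Prop :=
  ∀ (k : Fin K) (m m' : Messages M), m.upTo k = m'.upTo k → (Φ m).upTo k = (Φ m').upTo k

/-- Some messages that extend a prefix. -/
noncomputable def Prefix.extend (hM : ∀ k, 0 < M k) {k : Fin K} (p : Prefix M k) : Messages M :=
  fun l => if hl : l ≤ k then p ⟨l, hl⟩ else ⟨0, hM l⟩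

theorem Prefix.extend_upTo (hM : ∀ k, 0 < M k) {k : Fin K} (p : Prefix M k) :
    (p.extend hM).upTo k = p := by
  funext l
  simp [Messages.upTo, Prefix.extend, l.2]

/-- Scaling the codeword by `√g` amounts to using the original codeword at power `P g`. The codebook
is thus analysed at reduced power and transmitted scaled down. -/
theorem scale_received {n : ℕ} {P g : ℝ} (hP : 0 ≤ P) (h : ℂ) (x z : Fin n → ℂ) :
    received P h (fun i => ((Real.sqrt g : ℝ) : ℂ) * x i) z = received (P * g) h x z := by
  funext i
  simp only [received]
  rw [Real.sqrt_mul hP]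
  push_cast
  ring

/-- A codebook all of whose messages, in the range of `Φ`, are decoded with a probability of error
smaller than one yields an HARQ code for the messages re-indexed by `Φ`. -/
theorem exists_harqCode {P : Fin K → ℝ} {σ : ℝ} {h : Fin K → ℂ} {ε : ℝ} (hε : 0 < ε)
    (hM : ∀ k, 0 < M k) (hN : ∀ k, 0 < N k) (hP : ∀ k, 0 ≤ P k) (hσ : 0 < σ)
    {last : Fin K} (hlast : ∀ k, k ≤ last)
    {Φ : Messages M → Messages M'} (hΦ : Causal Φ) (hinj : Function.Injective Φ)
    (c : Codebook M' N) {e : ℝ} (he : e < 1)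
    (herr : ∀ m, (noiseLaw σ N).real {z | FailsAt (fun k => P k * (1 + ε * Real.log 2)⁻¹) σ h ε last
      (c, Φ m, z)} ≤ e) :
    ∃ C : HarqCode M N, C.maxError P σ h ≤ e := by
  classical
  have hl := Real.log_pos one_lt_two
  have := isProbabilityMeasure_noiseLaw (N := N) hσ
  have := nonempty_messages hM
  set g : ℝ := (1 + ε * Real.log 2)⁻¹ with hg
  have hg0 : 0 < g := by positivity
  set P' : Fin K → ℝ := fun k => P k * g
  have hupTo : Function.Injective fun m : Messages M' => m.upTo last := fun m m' hm =>
    funext fun l => congrFun hm ⟨l, hlast l⟩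
  let dec : Signal N → Messages M := fun y =>
    if H : ∃ m, typicalDecode P' σ h ε c y last = some ((Φ m).upTo last) then H.choose
    else Classical.arbitrary _
  have hdec : ∀ {y m}, typicalDecode P' σ h ε c y last = some ((Φ m).upTo last) →
      dec y = m := by
    intro y m hy
    have H : ∃ m, typicalDecode P' σ h ε c y last = some ((Φ m).upTo last) := ⟨m, hy⟩
    simp only [dec]
    rw [dif_pos H]
    have h1 := Option.some_inj.1 (hy.symm.trans H.choose_spec)
    exact (hinj (hupTo h1)).symm
  have hD := fun m : Messages M => measurableSet_typicalDecode (P := P') (σ := σ) (h := h)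
    (ε := ε) c last ((Φ m).upTo last)
  have hdecm : Measurable dec := by
    refine measurable_to_countable' fun m => ?_
    have hset : dec ⁻¹' {m} = {y | typicalDecode P' σ h ε c y last = some ((Φ m).upTo last)} ∪
        (if Classical.arbitrary _ = m then
          ⋂ m', {y | typicalDecode P' σ h ε c y last = some ((Φ m').upTo last)}ᶜ else ∅) := by
      ext y
      simp only [Set.mem_preimage, Set.mem_singleton_iff, Set.mem_union, Set.mem_ofPred_eq]
      by_cases H : ∃ m, typicalDecode P' σ h ε c y last = some ((Φ m).upTo last)
      · obtain ⟨m', hm'⟩ := H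
        rw [hdec hm', hm', Option.some_inj]
        constructor
        · rintro rfl
          exact Or.inl rfl
        · rintro (h1 | h1)
          · exact hinj (hupTo h1)
          · split_ifs at h1
            · exact absurd hm' (Set.mem_iInter.1 h1 m')
            · exact h1.elim
      · have h2 : dec y = Classical.arbitrary _ := dif_neg H
        rw [h2]
        constructor
        · intro h3
          rw [if_pos h3]
          exact Or.inr (Set.mem_iInter.2 fun m' hm' => H ⟨m', hm'⟩)
        · rintro (h1 | h1)
          · exact absurd ⟨m, h1⟩ H
          · by_contra hc
            rw [if_neg hc] at h1
            exact h1
    rw [hset]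
    refine (hD m).union ?_
    split_ifs
    · exact MeasurableSet.iInter fun m' => (hD m').compl
    · exact MeasurableSet.empty
  have hpower : ∀ (m : Messages M) (k : Fin K),
      ∑ i, ‖((Real.sqrt g : ℝ) : ℂ) * c k ((Φ m).upTo k) i‖ ^ 2 ≤ N k := by
    intro m k
    -- Error probability below 1 leaves some noise for which decoding succeeds. The codeword is then
    -- itself typical, so its energy is below `(1 + ε ln 2) N k`, which the scaling brings down to
    -- `N k`.
    have hex : ∃ z, ¬ FailsAt P' σ h ε last (c, Φ m, z) := by
      by_contra hc
      push Not at hc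
      have := herr m
      rw [show {z | FailsAt P' σ h ε last (c, Φ m, z)} = Set.univ from
        Set.eq_univ_of_forall hc, probReal_univ] at this
      linarith
    obtain ⟨z, hz⟩ := hex
    rw [failsAt_iff, not_not] at hz
    have ht := (hz.1 ⟨k, hlast k⟩).1
    have hNk : (0 : ℝ) < N k := by exact_mod_cast hN k
    rw [typical_gaussDensity_iff one_pos (hN k), mul_one, abs_lt] at ht
    have ht : (∑ i, ‖c k ((Φ m).upTo k) i‖ ^ 2) / N k < 1 + ε * Real.log 2 := by
      have := ht.2
      change (∑ i, ‖c k ((Φ m).upTo k) i‖ ^ 2) / N k - 1 < ε * Real.log 2 at this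
      linarith
    rw [div_lt_iff₀ hNk] at ht
    have h1 : ∀ i, ‖((Real.sqrt g : ℝ) : ℂ) * c k ((Φ m).upTo k) i‖ ^ 2
        = g * ‖c k ((Φ m).upTo k) i‖ ^ 2 := fun i => by
      rw [norm_mul, mul_pow, Complex.norm_real, Real.norm_eq_abs, sq_abs, Real.sq_sqrt hg0.le]
    simp_rw [h1]
    rw [← Finset.mul_sum]
    calc g * ∑ i, ‖c k ((Φ m).upTo k) i‖ ^ 2 ≤ g * ((1 + ε * Real.log 2) * N k) :=
          mul_le_mul_of_nonneg_left ht.le hg0.le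
      _ = N k := by rw [hg]; field_simp
  -- A prefix is encoded through an arbitrary extension; causality of `Φ` makes the codeword
  -- independent of that choice.
  refine ⟨⟨fun k p i => ((Real.sqrt g : ℝ) : ℂ) * c k ((Φ (p.extend hM)).upTo k) i, dec,
    fun k p => hpower _ k, hdecm⟩, ciSup_le fun m => (measureReal_mono ?_).trans (herr m)⟩
  intro z hz
  by_contra hc
  have hc : ¬ FailsAt P' σ h ε last (c, Φ m, z) := hc
  refine hz (hdec ?_)
  have h1 : receivedAll P h (fun k p i => ((Real.sqrt g : ℝ) : ℂ) *
      c k ((Φ (Prefix.extend hM p)).upTo k) i) m z = receivedAll P' h c (Φ m) z := by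
    funext k
    rw [receivedAll, receivedAll, scale_received (hP k),
      hΦ k _ m (Prefix.extend_upTo hM (m.upTo k))]
  rw [h1]
  exact not_not.1 hc

end Subcode

/-- The pairs of messages of two rounds. -/
def pairMessages {M : Fin 2 → ℕ} : Fin (M 0) × Fin (M 1) ≃ Messages M :=
  (piFinTwoEquiv fun k => Fin (M k)).symm

theorem card_messages_two (M : Fin 2 → ℕ) : Fintype.card (Messages M) = M 0 * M 1 := by
  simp [Fin.prod_univ_two]

/-- The error probabilities form a matrix indexed by the two messages. Expurgation keeps some rows
and, within each kept row, some columns depending on the row; this is causal, because the codeword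
of round 2 may depend on both messages. -/
theorem exists_harqCode_two {M M' N : Fin 2 → ℕ} {P : Fin 2 → ℝ} {σ : ℝ} {h : Fin 2 → ℂ}
    {ε : ℝ} (hε : 0 < ε) (hM : ∀ k, 0 < M k) (hM' : ∀ k, 0 < M' k)
    (hMM : ∀ k, 4 * M k ≤ 3 * M' k + 4) (hN : ∀ k, 0 < N k) (hP : ∀ k, 0 ≤ P k) (hσ : 0 < σ)
    {e : ℝ} (he0 : 0 ≤ e) (he : 16 * e < 1)
    (hexp : experiment σ M' N {q | FailsAt (fun k => P k * (1 + ε * Real.log 2)⁻¹) σ h ε 1 q}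
      ≤ ENNReal.ofReal e) :
    ∃ C : HarqCode M N, C.maxError P σ h ≤ 16 * e := by
  have hl := Real.log_pos one_lt_two
  have := isProbabilityMeasure_noiseLaw (N := N) hσ
  set P' : Fin 2 → ℝ := fun k => P k * (1 + ε * Real.log 2)⁻¹ with hP'
  have hP'0 : ∀ k, 0 ≤ P' k := fun k => mul_nonneg (hP k) (by positivity)
  obtain ⟨c, hc⟩ := exists_codebook_sum_le h ε hM' hN hP'0 hσ 1
  set err : Messages M' → ℝ := fun m => (noiseLaw σ N).real {z | FailsAt P' σ h ε 1 (c, m, z)}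
    with herr
  have hsum : ∑ i, ∑ j, err (pairMessages (i, j)) ≤ (M' 0 : ℝ) * M' 1 * e := by
    rw [← Fintype.sum_prod_type' (f := fun i j => err (pairMessages (i, j))),
      Equiv.sum_comp pairMessages err]
    have h1 : ∑ m, err m = (∑ m, noiseLaw σ N {z | FailsAt P' σ h ε 1 (c, m, z)}).toReal := by
      rw [ENNReal.toReal_sum fun m _ => measure_ne_top _ _]
      rfl
    have h2 : ∑ m, noiseLaw σ N {z | FailsAt P' σ h ε 1 (c, m, z)}
        ≤ ENNReal.ofReal ((M' 0 : ℝ) * M' 1 * e) := by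
      refine hc.trans ?_
      rw [ENNReal.ofReal_mul (by positivity), card_messages_two]
      refine mul_le_mul' (le_of_eq ?_) hexp
      rw [← Nat.cast_mul, ENNReal.ofReal_natCast]
    rw [h1]
    exact ENNReal.toReal_le_of_le_ofReal (by positivity) h2
  obtain ⟨φ, ψ, hφ, hψ, hφψ⟩ := exists_expurgation (a := M 0) (b := M 1) (hM' 0) (hM' 1)
    (hMM 0) (hMM 1) (fun i j => measureReal_nonneg) hsum
  let Φ : Messages M → Messages M' := fun m => pairMessages (φ (m 0), ψ (m 0) (m 1))
  have hΦc : Causal Φ := by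
    intro k m m' hm
    have hk : ∀ l ≤ k, m l = m' l := fun l hl => congrFun hm ⟨l, hl⟩
    funext ⟨l, hl⟩
    change Φ m l = Φ m' l
    have h0 : m 0 = m' 0 := hk 0 (Fin.zero_le _)
    fin_cases l
    · change φ (m 0) = φ (m' 0)
      rw [h0]
    · change ψ (m 0) (m 1) = ψ (m' 0) (m' 1)
      rw [h0, hk 1 hl]
  have hΦi : Function.Injective Φ := by
    intro m m' hm
    have h1 := Prod.ext_iff.1 (pairMessages.injective hm)
    have h0 : m 0 = m' 0 := hφ h1.1
    have h2 : ψ (m 0) (m 1) = ψ (m' 0) (m' 1) := h1.2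
    rw [h0] at h2
    funext l
    fin_cases l
    · exact h0
    · exact hψ _ h2
  exact exists_harqCode hε hM hN hP hσ (last := 1) (fun k => Fin.le_last k) hΦc hΦi c he
    fun m => hφψ (m 0) (m 1)

theorem nonempty_harqCode {K : ℕ} {M N : Fin K → ℕ} (hM : ∀ k, 0 < M k) :
    Nonempty (HarqCode M N) :=
  ⟨⟨fun _ _ _ => 0, fun _ k => ⟨0, hM k⟩, fun k _ => by simp, measurable_const⟩⟩

/-- Halving the back-off multiplies `2 ^ (n (b - δ))` by `2 ^ (n δ / 2) ≥ 4`, which leaves room for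
discarding messages. At `b k ≤ δ` a single message remains. -/
theorem numMessages_expurgation {K : ℕ} (b : Fin K → ℝ) {δ : ℝ} {n : ℕ}
    (hn : 4 ≤ n * δ) (k : Fin K) :
    4 * numMessages b δ n k ≤ 3 * numMessages b (δ / 2) n k + 4 := by
  rcases le_or_gt (b k) δ with hb | hb
  · rw [numMessages_eq_one hb]
    omega
  · set x : ℝ := 2 ^ ((n : ℝ) * (b k - δ)) with hx
    have hx1 : 0 < x := by positivity
    have h1 : (numMessages b δ n k : ℝ) ≤ x + 1 := (Nat.ceil_lt_add_one hx1.le).le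
    have h2 : 4 * x ≤ numMessages b (δ / 2) n k := by
      refine le_trans ?_ (le_numMessages b (δ / 2) n k)
      have : (n : ℝ) * (b k - δ / 2) = n * (b k - δ) + n * δ / 2 := by ring
      rw [this, Real.rpow_add two_pos, ← hx, mul_comm]
      refine mul_le_mul_of_nonneg_left ?_ hx1.le
      calc (4 : ℝ) = 2 ^ (2 : ℝ) := by norm_num
        _ ≤ _ := Real.rpow_le_rpow_of_exponent_le one_le_two (by linarith)
    have h3 : (4 * numMessages b δ n k : ℝ) ≤ 3 * numMessages b (δ / 2) n k + 4 := by linarith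
    exact_mod_cast h3

/-- With `g = 1 + ε ln 2`, one has `1 + γ ≤ (1 + γ / g) g` and `log₂ g ≤ ε`: reducing the power
costs at most `ε` bits per symbol, the slack allowed in the capacity condition. -/
theorem logb_one_add_snr_le {P σ ε : ℝ} (hP : 0 ≤ P) (hε : 0 < ε) (h : ℂ) :
    Real.logb 2 (1 + snr P σ h)
      ≤ Real.logb 2 (1 + snr (P * (1 + ε * Real.log 2)⁻¹) σ h) + ε := by
  have hl := Real.log_pos one_lt_two
  have hg : 0 < 1 + ε * Real.log 2 := by positivity
  have hs := snr_nonneg hP σ h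
  have h1 : snr (P * (1 + ε * Real.log 2)⁻¹) σ h = snr P σ h * (1 + ε * Real.log 2)⁻¹ := by
    unfold snr
    ring
  have hpos : 0 < 1 + snr P σ h * (1 + ε * Real.log 2)⁻¹ := by positivity
  rw [h1, Real.logb, Real.logb, div_add' _ _ _ hl.ne', div_le_div_iff_of_pos_right hl]
  calc Real.log (1 + snr P σ h)
      ≤ Real.log ((1 + snr P σ h * (1 + ε * Real.log 2)⁻¹) * (1 + ε * Real.log 2)) := by
        refine Real.log_le_log (by linarith) ?_
        rw [add_mul, mul_assoc, inv_mul_cancel₀ hg.ne']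
        linarith [mul_pos hε hl]
    _ = Real.log (1 + snr P σ h * (1 + ε * Real.log 2)⁻¹) + Real.log (1 + ε * Real.log 2) :=
        Real.log_mul hpos.ne' hg.ne'
    _ ≤ _ := by linarith [Real.log_le_sub_one_of_pos hg]

end XPHARQ

namespace XPHARQ

/-! ### Two rounds -/

section TwoRounds

variable {N : Fin 2 → ℕ} {P : Fin 2 → ℝ} {σ : ℝ} {h : Fin 2 → ℂ} {b : Fin 2 → ℝ}

theorem sum_Icc_le_of_two {f g : Fin 2 → ℝ} (h0 : f 0 + f 1 ≤ g 0 + g 1) (h1 : f 1 ≤ g 1)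
    (j : Fin 2) : ∑ l ∈ Finset.Icc j 1, f l ≤ ∑ l ∈ Finset.Icc j 1, g l := by
  fin_cases j
  · have : Finset.Icc (0 : Fin 2) 1 = Finset.univ := by decide
    change ∑ l ∈ Finset.Icc (0 : Fin 2) 1, f l ≤ ∑ l ∈ Finset.Icc (0 : Fin 2) 1, g l
    rw [this, Fin.sum_univ_two, Fin.sum_univ_two]
    exact h0
  · simpa using h1

theorem sum_blocks_pos (hN : ∀ k, 0 < N k) : 0 < ∑ l, (N l : ℝ) :=
  Finset.sum_pos (fun l _ => by exact_mod_cast hN l) Finset.univ_nonempty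

theorem tendsto_failure_two (hN : ∀ k, 0 < N k) (hP : ∀ k, 0 < P k) (hσ : 0 < σ)
    (hb : ∀ k, 0 ≤ b k)
    (h01 : b 0 + b 1 ≤ N 0 * Real.logb 2 (1 + snr (P 0) σ (h 0)) +
      N 1 * Real.logb 2 (1 + snr (P 1) σ (h 1)))
    (h1 : b 1 ≤ N 1 * Real.logb 2 (1 + snr (P 1) σ (h 1))) {δ : ℝ} (hδ : 0 < δ) :
    ∀ᶠ ε in 𝓝[>] (0 : ℝ), Tendsto
      (fun n : ℕ => (experiment σ (numMessages b δ n) (blockLength N n)).real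
        {e | FailsAt P σ h ε 1 e}) atTop (𝓝 0) := by
  have hS := sum_blocks_pos hN
  have hε0 : 0 < δ / (8 * ∑ l, (N l : ℝ)) := by positivity
  filter_upwards [Ioo_mem_nhdsGT hε0] with ε hε
  have hεδ : 8 * ε * ∑ l, (N l : ℝ) ≤ δ := by
    have := (lt_div_iff₀ (by positivity)).1 hε.2
    linarith
  refine squeeze_zero' (Eventually.of_forall fun n => measureReal_nonneg) ?_
    (tendsto_directError 2 (ε := ε) hδ)
  filter_upwards [eventually_gt_atTop 0] with n hn
  refine ENNReal.toReal_le_of_le_ofReal (directError_nonneg _ _ _ _)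
    (experiment_failsAt_le_directError hN (fun k => (hP k).le) hσ hb hε.1 hεδ
      (fun j _ => sum_Icc_le_of_two ?_ ?_ j) hn)
  · have e0 := mul_nonneg (N 0).cast_nonneg hε.1.le
    have e1 := mul_nonneg (N 1).cast_nonneg hε.1.le
    linarith
  · have e1 := mul_nonneg (N 1).cast_nonneg hε.1.le
    linarith

theorem exists_codes_two (hN : ∀ k, 0 < N k) (hP : ∀ k, 0 < P k) (hσ : 0 < σ)
    (hb : ∀ k, 0 ≤ b k)
    (h01 : b 0 + b 1 ≤ N 0 * Real.logb 2 (1 + snr (P 0) σ (h 0)) +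
      N 1 * Real.logb 2 (1 + snr (P 1) σ (h 1)))
    (h1 : b 1 ≤ N 1 * Real.logb 2 (1 + snr (P 1) σ (h 1))) {δ : ℝ} (hδ : 0 < δ) :
    ∃ c : (n : ℕ) → HarqCode (numMessages b δ n) (blockLength N n),
      Tendsto (fun n => (c n).maxError P σ h) atTop (𝓝 0) := by
  classical
  have hS := sum_blocks_pos hN
  -- The random codebook is drawn with back-off `δ / 2`, the other half being reserved for
  -- expurgation; `ε` solves `8 ε ∑ N l = δ / 2`.
  set ε : ℝ := δ / 2 / (8 * ∑ l, (N l : ℝ)) with hεdef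
  have hε : 0 < ε := by positivity
  have hεδ : 8 * ε * ∑ l, (N l : ℝ) ≤ δ / 2 := by
    rw [hεdef]
    apply le_of_eq
    field_simp
  have hlim := tendsto_directError 2 (ε := ε) (half_pos hδ)
  have hlim16 := hlim.const_mul (16 : ℝ)
  rw [mul_zero] at hlim16
  have hcode : ∀ᶠ n : ℕ in atTop, ∃ c : HarqCode (numMessages b δ n) (blockLength N n),
      c.maxError P σ h ≤ 16 * directError 2 ε (δ / 2) n := by
    have hn4 : ∀ᶠ n : ℕ in atTop, 4 ≤ (n : ℝ) * δ :=
      (tendsto_natCast_atTop_atTop.atTop_mul_const hδ).eventually_ge_atTop 4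
    filter_upwards [eventually_gt_atTop 0, hn4, hlim16.eventually_lt_const one_pos]
      with n hn hn4 hn16
    refine exists_harqCode_two hε (one_le_numMessages b δ n) (one_le_numMessages b (δ / 2) n)
      (numMessages_expurgation b hn4) (blockLength_pos hN hn) (fun k => (hP k).le) hσ
      (directError_nonneg _ _ _ _) hn16 ?_
    have hl := Real.log_pos one_lt_two
    refine experiment_failsAt_le_directError hN (fun k => mul_nonneg (hP k).le (by positivity))
      hσ hb hε hεδ (fun j _ => sum_Icc_le_of_two ?_ ?_ j) hn
    · have e0 := mul_le_mul_of_nonneg_left (logb_one_add_snr_le (σ := σ) (hP 0).le hε (h 0))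
        (N 0).cast_nonneg
      have e1 := mul_le_mul_of_nonneg_left (logb_one_add_snr_le (σ := σ) (hP 1).le hε (h 1))
        (N 1).cast_nonneg
      linarith
    · have e1 := mul_le_mul_of_nonneg_left (logb_one_add_snr_le (σ := σ) (hP 1).le hε (h 1))
        (N 1).cast_nonneg
      linarith
  -- An arbitrary code serves for those `n` at which the bound is not available.
  refine ⟨fun n => if H : ∃ c : HarqCode (numMessages b δ n) (blockLength N n),
      c.maxError P σ h ≤ 16 * directError 2 ε (δ / 2) n then H.choose
    else (nonempty_harqCode (one_le_numMessages b δ n)).some, ?_⟩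
  refine squeeze_zero' (Eventually.of_forall fun n => Real.iSup_nonneg fun m => measureReal_nonneg)
    ?_ hlim16
  filter_upwards [hcode] with n hn
  rw [dif_pos hn]
  exact hn.choose_spec

end TwoRounds

/-! ### Outage -/

theorem measureReal_prod_le {Ω E : Type*} [MeasurableSpace Ω] [MeasurableSpace E]
    (μ : Measure Ω) [IsProbabilityMeasure μ] (ν : Measure E) [IsProbabilityMeasure ν]
    {T : Set (Ω × E)} (hT : MeasurableSet T) {B : Set Ω} (hB : MeasurableSet B) {r : ℝ}
    (hr : 0 ≤ r) (h : ∀ ω ∉ B, ν {e | (ω, e) ∈ T} ≤ ENNReal.ofReal r) :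
    (μ.prod ν).real T ≤ μ.real B + r := by
  refine ENNReal.toReal_le_of_le_ofReal (add_nonneg measureReal_nonneg hr) ?_
  rw [Measure.prod_apply hT, ENNReal.ofReal_add measureReal_nonneg hr, measureReal_def,
    ENNReal.ofReal_toReal (measure_ne_top _ _)]
  calc _ ≤ ∫⁻ ω, B.indicator 1 ω + ENNReal.ofReal r ∂μ := by
        refine lintegral_mono fun ω => ?_
        by_cases hω : ω ∈ B
        · simp only [Set.indicator_of_mem hω, Pi.one_apply]
          exact prob_le_one.trans le_self_add
        · exact (h ω hω).trans le_add_self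
    _ = _ := by
        rw [lintegral_add_right _ measurable_const, lintegral_indicator_one hB, lintegral_const,
          measure_univ, mul_one]

/-- In the first round in which the accumulated information suffices, it suffices for all suffixes
of the rounds. -/
theorem exists_sum_Icc_le {K : ℕ} {f g : Fin K → ℝ}
    (h : ∃ k, ∑ l ∈ Finset.Iic k, f l ≤ ∑ l ∈ Finset.Iic k, g l) :
    ∃ k, ∀ j ≤ k, ∑ l ∈ Finset.Icc j k, f l ≤ ∑ l ∈ Finset.Icc j k, g l := by
  classical
  have hne : (Finset.univ.filter fun k : Fin K =>
      ∑ l ∈ Finset.Iic k, f l ≤ ∑ l ∈ Finset.Iic k, g l).Nonempty := by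
    obtain ⟨k, hk⟩ := h
    exact ⟨k, Finset.mem_filter.2 ⟨Finset.mem_univ _, hk⟩⟩
  obtain ⟨k, hk, hmin⟩ := Finset.exists_minimal hne
  have hk := (Finset.mem_filter.1 hk).2
  refine ⟨k, fun j hj => ?_⟩
  have hsplit : ∀ u : Fin K → ℝ,
      ∑ l ∈ Finset.Iic k, u l = ∑ l ∈ Finset.Iio j, u l + ∑ l ∈ Finset.Icc j k, u l := by
    intro u
    rw [← Finset.sum_union]
    · congr 1
      ext l
      simp only [Finset.mem_Iic, Finset.mem_union, Finset.mem_Iio, Finset.mem_Icc]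
      constructor
      · intro hl
        rcases lt_or_ge l j with hlj | hlj
        · exact Or.inl hlj
        · exact Or.inr ⟨hlj, hl⟩
      · rintro (hl | hl)
        · exact hl.le.trans hj
        · exact hl.2
    · refine Finset.disjoint_left.2 fun l hl hl' => ?_
      exact absurd (Finset.mem_Iio.1 hl) (not_lt.2 (Finset.mem_Icc.1 hl').1)
  -- By minimality of `k` the information was short just before round `j`; if `j` is the first
  -- round, both sums are empty. Subtracting from the inequality at `k` leaves the suffix
  -- inequality.
  have hbefore : ∑ l ∈ Finset.Iio j, g l ≤ ∑ l ∈ Finset.Iio j, f l := by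
    rcases Nat.eq_zero_or_pos j.1 with h0 | h0
    · have : Finset.Iio j = ∅ := by
        ext l
        simp only [Finset.mem_Iio, Finset.notMem_empty, iff_false, not_lt]
        exact Fin.le_def.2 (by omega)
      rw [this, Finset.sum_empty, Finset.sum_empty]
    · obtain ⟨i, hi⟩ : ∃ i : Fin K, i.1 + 1 = j.1 := ⟨⟨j.1 - 1, by omega⟩, by
        change j.1 - 1 + 1 = j.1
        omega⟩
      have : Finset.Iio j = Finset.Iic i := by
        ext l
        simp only [Finset.mem_Iio, Finset.mem_Iic, Fin.lt_def, Fin.le_def]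
        omega
      rw [this]
      by_contra hc
      have hik : i < k := Fin.lt_def.2 (by have := Fin.le_def.1 hj; omega)
      have := hmin (Finset.mem_filter.2 ⟨Finset.mem_univ i, (not_le.1 hc).le⟩) hik.le
      exact absurd hik (not_lt.2 this)
  have e1 := hsplit f
  have e2 := hsplit g
  linarith

section Outage

variable {K : ℕ} {N : Fin K → ℕ} {P : Fin K → ℝ} {σ : ℝ} {b : Fin K → ℝ}

/-- The information, in bits per unit of scale, accumulated in the rounds up to `k`. -/
noncomputable def accumulated (N : Fin K → ℕ) (P : Fin K → ℝ) (σ : ℝ) (h : Fin K → ℂ)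
    (k : Fin K) : ℝ :=
  ∑ l ∈ Finset.Iic k, (N l : ℝ) * Real.logb 2 (1 + snr (P l) σ (h l))

variable {Ω : Type*} {h : Ω → Fin K → ℂ}

/-- The channel states for which the accumulated information is less by `r` than the accumulated
rate, after all the rounds. -/
def deficient (N : Fin K → ℕ) (P : Fin K → ℝ) (σ : ℝ) (b : Fin K → ℝ) (h : Ω → Fin K → ℂ)
    (r : ℝ) : Set Ω :=
  {ω | ∀ k, accumulated N P σ (h ω) k ≤ ∑ l ∈ Finset.Iic k, b l - r}

theorem deficient_anti {r r' : ℝ} (hr : r ≤ r') :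
    deficient N P σ b h r' ⊆ deficient N P σ b h r :=
  fun ω hω k => (hω k).trans (by linarith)

variable [MeasurableSpace Ω]

theorem measurable_accumulated (hh : Measurable h) (k : Fin K) :
    Measurable fun ω => accumulated N P σ (h ω) k := by
  unfold accumulated snr Real.logb
  have : ∀ l, Measurable fun ω => h ω l := fun l => (measurable_pi_apply l).comp hh
  fun_prop

theorem measurableSet_deficient (hh : Measurable h) (r : ℝ) :
    MeasurableSet (deficient N P σ b h r) := by
  unfold deficient
  rw [Set.ofPred_forall]
  exact MeasurableSet.iInter fun k =>
    measurableSet_le (measurable_accumulated hh k) measurable_const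

/-- The outage event is the increasing union of the deficient sets with margins `1 / (n + 1)`, as
finitely many strict inequalities have a common positive gap. Continuity from below concludes. -/
theorem exists_deficient (μ : Measure Ω) [IsProbabilityMeasure μ] {η : ℝ} (hη : 0 < η) :
    ∃ r > 0, μ.real {ω | ∀ k, accumulated N P σ (h ω) k < ∑ l ∈ Finset.Iic k, b l} - η
      < μ.real (deficient N P σ b h r) := by
  set A := {ω | ∀ k, accumulated N P σ (h ω) k < ∑ l ∈ Finset.Iic k, b l} with hA
  set D : ℕ → Set Ω := fun n => deficient N P σ b h (1 / ((n : ℝ) + 1)) with hD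
  have hmono : Monotone D := fun n n' hn => deficient_anti (by gcongr)
  have hU : ⋃ n, D n = A := by
    ext ω
    simp only [Set.mem_iUnion]
    constructor
    · rintro ⟨n, hn⟩ k
      have h1 : 0 < 1 / ((n : ℝ) + 1) := by positivity
      have := hn k
      linarith
    · intro hω
      have h1 : ∀ᶠ n : ℕ in atTop, ∀ k, 1 / ((n : ℝ) + 1)
          < ∑ l ∈ Finset.Iic k, b l - accumulated N P σ (h ω) k :=
        eventually_all.2 fun k => tendsto_one_div_add_atTop_nhds_zero_nat.eventually_lt_const
          (by have := hω k; linarith)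
      obtain ⟨n, hn⟩ := h1.exists
      refine ⟨n, fun k => ?_⟩
      have := hn k
      linarith
  have hlim := tendsto_measure_iUnion_atTop (μ := μ) hmono
  rw [hU] at hlim
  have hlim' : Tendsto (fun n => μ.real (D n)) atTop (𝓝 (μ.real A)) :=
    (ENNReal.tendsto_toReal (measure_ne_top μ A)).comp hlim
  obtain ⟨n, hn⟩ := (hlim'.eventually_const_lt (by linarith : μ.real A - η < μ.real A)).exists
  exact ⟨1 / ((n : ℝ) + 1), by positivity, hn⟩

theorem isOutageProb (hN : ∀ k, 0 < N k) (hP : ∀ k, 0 < P k) (hσ : 0 < σ) (hb : ∀ k, 0 ≤ b k)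
    (μ : Measure Ω) [IsProbabilityMeasure μ] (hh : Measurable h) :
    IsOutageProb μ h P σ b N
      (μ.real {ω | ∀ k, accumulated N P σ (h ω) k < ∑ l ∈ Finset.Iic k, b l}) := by
  have hP' : ∀ k, 0 ≤ P k := fun k => (hP k).le
  set A := {ω | ∀ k, accumulated N P σ (h ω) k < ∑ l ∈ Finset.Iic k, b l} with hA
  have hAm : MeasurableSet A := by
    rw [hA, Set.ofPred_forall]
    exact MeasurableSet.iInter fun k =>
      measurableSet_lt (measurable_accumulated hh k) measurable_const
  intro η hη
  obtain ⟨r, hr, hAr⟩ := exists_deficient (N := N) (P := P) (σ := σ) (b := b) (h := h) μ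
    (half_pos hη)
  have hK : (0 : ℝ) < K + 1 := by positivity
  -- `δ < r / (K + 1)` lets the margin `r` absorb the back-off required by the converse in each
  -- round.
  filter_upwards [Ioo_mem_nhdsGT (div_pos hr hK)] with δ hδ
  -- The added 1 keeps the denominator positive when `K = 0`.
  have hS : 0 < ∑ l, (N l : ℝ) + 1 := by positivity
  filter_upwards [Ioo_mem_nhdsGT (div_pos hδ.1 (by positivity : 0 < 8 * (∑ l, (N l : ℝ) + 1)))]
    with ε hε
  have hεδ : 8 * ε * ∑ l, (N l : ℝ) ≤ δ := by
    have := (lt_div_iff₀ (by positivity)).1 hε.2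
    linarith [hε.1]
  have hlim1 := tendsto_directError K (ε := ε) hδ.1
  have hlim2 := (tendsto_two_rpow_neg hδ.1).const_mul (K : ℝ)
  rw [mul_zero] at hlim2
  filter_upwards [eventually_gt_atTop 0, hlim1.eventually_lt_const hη,
    hlim2.eventually_lt_const (half_pos hη)] with n hn hn1 hn2
  set M := numMessages b δ n
  set L := blockLength N n
  have hM : ∀ k, 0 < M k := one_le_numMessages b δ n
  have hL : ∀ k, 0 < L k := blockLength_pos hN hn
  have := isProbabilityMeasure_experiment (N := L) hσ hM
  set T : Set (Ω × Codebook M L × Messages M × Signal L) :=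
    {q | ∀ k, FailsAt P σ (h q.1) ε k q.2} with hT
  have hTm : MeasurableSet T := by
    rw [hT, Set.ofPred_forall]
    exact MeasurableSet.iInter fun k => (measurableSet_failsAt hL hP' hσ ε k).preimage
      (f := fun q : Ω × Codebook M L × Messages M × Signal L => (h q.1, q.2)) (by fun_prop)
  -- Off the outage event, decoding succeeds with high probability in the first round with enough
  -- information. Equality of information and rate is harmless thanks to the back-off.
  have hupper : (μ.prod (experiment σ M L)).real T ≤ μ.real A + directError K ε δ n := by
    refine measureReal_prod_le μ _ hTm hAm (directError_nonneg _ _ _ _) fun ω hω => ?_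
    have hex : ∃ k, ∑ l ∈ Finset.Iic k, b l ≤ ∑ l ∈ Finset.Iic k,
        (N l : ℝ) * Real.logb 2 (1 + snr (P l) σ (h ω l)) := by
      by_contra hc
      push Not at hc
      exact hω hc
    obtain ⟨k, hk⟩ := exists_sum_Icc_le hex
    refine (measure_mono (t := {e | FailsAt P σ (h ω) ε k e}) fun e he =>
      (show ∀ k, FailsAt P σ (h ω) ε k e from he) k).trans
      (experiment_failsAt_le_directError hN hP' hσ hb hε.1 hεδ (fun j hj => ?_) hn)
    refine (hk j hj).trans (Finset.sum_le_sum fun l _ => ?_)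
    exact mul_le_mul_of_nonneg_left (by linarith [hε.1]) (N l).cast_nonneg
  have hDm := measurableSet_deficient (N := N) (P := P) (σ := σ) (b := b) hh r
  -- On deficient states, success in any of the `K` rounds is exponentially rare, by the union
  -- bound; the complement of `T` is the event of some success.
  have hlower : (μ.prod (experiment σ M L)).real Tᶜ
      ≤ μ.real (deficient N P σ b h r)ᶜ + K * 2 ^ (-((n : ℝ) * (δ / 2))) := by
    refine measureReal_prod_le μ _ hTm.compl hDm.compl (by positivity) fun ω hω => ?_
    have hω : ω ∈ deficient N P σ b h r := Set.notMem_compl_iff.1 hω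
    have hsub : {e | (ω, e) ∈ Tᶜ} ⊆ ⋃ k, {e | ¬ FailsAt P σ (h ω) ε k e} := by
      intro e he
      have he : ¬ ∀ k, FailsAt P σ (h ω) ε k e := he
      push Not at he
      exact Set.mem_iUnion.2 he
    have hrδ : (K + 1) * δ ≤ r := by
      have := (lt_div_iff₀ hK).1 hδ.2
      linarith
    refine (measure_mono hsub).trans ((measure_iUnion_fintype_le _ _).trans ?_)
    refine (Finset.sum_le_card_nsmul _ _ (ENNReal.ofReal (2 ^ (-((n : ℝ) * (δ / 2)))))
      fun k _ => experiment_not_failsAt_le_two_rpow hN hP' hσ hε.1 hεδ ?_ hn).trans_eq ?_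
    · have := hω k
      rw [accumulated] at this
      linarith
    · rw [Finset.card_univ, Fintype.card_fin, nsmul_eq_mul, ENNReal.ofReal_mul (by positivity),
        ENNReal.ofReal_natCast]
  rw [probReal_compl_eq_one_sub hTm, probReal_compl_eq_one_sub hDm] at hlower
  change |(μ.prod (experiment σ M L)).real T - μ.real A| < η
  rw [abs_lt]
  constructor <;> linarith

end Outage

end XPHARQ

theorem mainTheorem4 :
    -- the mutual information of one round
    (∀ (n : ℕ) (P σ : ℝ) (h : ℂ), 0 < P → 0 < σ →
      XPHARQ.mutualInfoNats (XPHARQ.inputOutputLaw n P σ h) ≠ ⊤ ∧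
      XPHARQ.mutualInfo n P σ h = n * Real.logb 2 (1 + XPHARQ.snr P σ h)) ∧
    -- achievability for two rounds
    (∀ (N : Fin 2 → ℕ) (P : Fin 2 → ℝ) (σ : ℝ) (h : Fin 2 → ℂ) (b : Fin 2 → ℝ),
      (∀ k, 0 < N k) → (∀ k, 0 < P k) → 0 < σ → (∀ k, 0 ≤ b k) →
      b 0 + b 1 ≤ XPHARQ.mutualInfo (N 0) (P 0) σ (h 0) +
        XPHARQ.mutualInfo (N 1) (P 1) σ (h 1) →
      b 1 ≤ XPHARQ.mutualInfo (N 1) (P 1) σ (h 1) →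
      b 0 ≤ XPHARQ.mutualInfo (N 0) (P 0) σ (h 0) +
        XPHARQ.mutualInfo (N 1) (P 1) σ (h 1) →
      ∀ δ : ℝ, 0 < δ →
        -- Gaussian codebooks with joint-typicality decoding have vanishing error
        (∀ᶠ ε in 𝓝[>] (0 : ℝ), Tendsto
          (fun n : ℕ => (XPHARQ.experiment σ (XPHARQ.numMessages b δ n)
            (XPHARQ.blockLength N n)).real {e | XPHARQ.FailsAt P σ h ε 1 e})
          atTop (𝓝 0)) ∧
        -- there are codes whose maximal probability of error vanishes
        ∃ c : (n : ℕ) → XPHARQ.HarqCode (XPHARQ.numMessages b δ n) (XPHARQ.blockLength N n),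
          Tendsto (fun n => (c n).maxError P σ h) atTop (𝓝 0)) ∧
    -- the outage probability after `K` rounds
    (∀ (K : ℕ) (N : Fin K → ℕ) (P : Fin K → ℝ) (σ : ℝ) (b : Fin K → ℝ),
      (∀ k, 0 < N k) → (∀ k, 0 < P k) → 0 < σ → (∀ k, 0 ≤ b k) →
      ∀ {Ω : Type*} [MeasurableSpace Ω] (μ : Measure Ω) [IsProbabilityMeasure μ]
        (h : Ω → Fin K → ℂ), Measurable h →
      XPHARQ.IsOutageProb μ h P σ b N
        (μ.real (⋂ k : Fin K, {ω | ∑ l ∈ Finset.univ.filter (fun l => l ≤ k),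
            (N l : ℝ) * Real.logb 2 (1 + XPHARQ.snr (P l) σ (h ω l)) <
          ∑ l ∈ Finset.univ.filter (fun l => l ≤ k), b l}))) := by
  refine ⟨fun n P σ h hP hσ => XPHARQ.mutualInfo_eq hP hσ, ?_, ?_⟩
  · intro N P σ h b hN hP hσ hb h01 h1 _ δ hδ
    rw [(XPHARQ.mutualInfo_eq (hP 0) hσ).2, (XPHARQ.mutualInfo_eq (hP 1) hσ).2] at h01
    rw [(XPHARQ.mutualInfo_eq (hP 1) hσ).2] at h1
    exact ⟨XPHARQ.tendsto_failure_two hN hP hσ hb h01 h1 hδ,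
      XPHARQ.exists_codes_two hN hP hσ hb h01 h1 hδ⟩
  · intro K N P σ b hN hP hσ hb Ω _ μ _ h hh
    have hset : (⋂ k : Fin K, {ω | ∑ l ∈ Finset.univ.filter (fun l => l ≤ k),
          (N l : ℝ) * Real.logb 2 (1 + XPHARQ.snr (P l) σ (h ω l)) <
        ∑ l ∈ Finset.univ.filter (fun l => l ≤ k), b l})
        = {ω | ∀ k, XPHARQ.accumulated N P σ (h ω) k < ∑ l ∈ Finset.Iic k, b l} := by
      have hf : ∀ k : Fin K, Finset.univ.filter (fun l => l ≤ k) = Finset.Iic k := fun k => by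
        ext
        simp
      ext ω
      simp only [Set.mem_iInter, Set.mem_ofPred_eq, hf, XPHARQ.accumulated]
    rw [hset]
    exact XPHARQ.isOutageProb hN hP hσ hb μ hh
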